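/- **Theorem 1.5.** Let $n\ge 1$ and let $P$ be a full-dimensional convex polytope in $\mathbb{R}^n$ with $d$ facets and vertex set $V(P)$, $N=|V(P)|$. View $\mathbb{R}^n$ in complex projective space $\mathbb{P}^n$ by $x\mapsto(1:x_1:\dots:x_n)$. For a facet $F$ let $\ell_F$ be a homogeneous linear form on $\mathbb{C}^{n+1}$ defining the hyperplane spanned by $F$, and let $\mathcal{H}_P$ be the arrangement of these $d$ hyperplanes. Assume that $\mathcal{H}_P$ is simple, that is, at most $n$ of its hyperplanes pass through any point of $\mathbb{P}^n$. Let $\mathcal{R}_P\subset\mathbb{P}^n$ be the residual arrangement, the union of all intersections of hyperplanes of $\mathcal{H}_P$ that contain no (non-empty) face of $P$, and let $\Omega_P$ be the space of homogeneous forms of degree $d-n$ on $\mathbb{P}^n$ vanishing on $\mathcal{R}_P$. Then: (a) Up to scaling there is exactly one nonzero homogeneous form of degree $d-n-1$ vanishing on $\mathcal{R}_P$; its zero locus is the adjoint hypersurface $A_P$. The $N$ forms $\omega_u=\prod_{F\not\ni u}\ell_F$ $(u\in V(P))$ are a basis of $\Omega_P$. Thus the Wachspress map $\omega_P:\mathbb{P}^n\dashrightarrow\mathbb{P}^{N-1}$,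 $t\mapsto(\omega_u(t))_{u\in V(P)}$, defined where the $\omega_u$ do not all vanish, is a map to $\mathbb{P}(\Omega_P^*)\cong\mathbb{P}^{N-1}$. (b) The projective span $\mathbb{V}_P=\mathrm{span}\{\omega_P(A_P)\}\subset\mathbb{P}(\Omega_P^*)$ of the image of $A_P$ (of the points of $A_P$ at which $\omega_P$ is defined) has dimension $N-n-2$, where the empty subspace has dimension $-1$. (c) Let $W_P\subset\mathbb{P}(\Omega_P^*)$ be the Wachspress variety, the Zariski closure of the image of $\omega_P$. The linear projection $\rho_P:\mathbb{P}(\Omega_P^*)\dashrightarrow\mathbb{P}^n$ from $\mathbb{V}_P$ (for a suitable choice of linear coordinates on its target), restricted to $W_P$, is the inverse of the rational map $\omega_P:\mathbb{P}^n\dashrightarrow W_P$: the compositions $\rho_P\circ\omega_P$ on $\mathbb{P}^n$ and $\omega_P\circ\rho_P|_{W_P}$ on $W_P$ are defined on Zariski-dense subsets, and each of them is the identity at every point where it is defined. -/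

import Mathlib

open scoped LinearAlgebra.Projectivization

namespace Wachspress

noncomputable section

/-! ### Subsets of complex projective space and rational maps between them -/

/-- `ℙ^m`-type projective spaces, with homogeneous coordinates indexed by `σ`. -/
abbrev ProjSpace (σ : Type) : Type := ℙ ℂ (σ → ℂ)

/-- The homogeneous form `f` vanishes at the point `p`. (For homogeneous `f` this does not depend
on the vector of homogeneous coordinates that represents `p`.) -/
def VanishesAt {σ : Type} (f : MvPolynomial σ ℂ) (p : ProjSpace σ) : Prop :=
  MvPolynomial.eval p.rep f = 0

/-- Zariski closure in projective space: the common zero locus of all homogeneous forms that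
vanish on `S`. -/
def zariskiClosure {σ : Type} (S : Set (ProjSpace σ)) : Set (ProjSpace σ) :=
  {p | ∀ (m : ℕ) (f : MvPolynomial σ ℂ), f.IsHomogeneous m →
    (∀ q ∈ S, VanishesAt f q) → VanishesAt f p}

/-- The rational map `p ↦ (F_j(p))_j` given by a family of homogeneous forms of the same degree; it
is defined where not all of the forms vanish. -/
def formsMap {σ τ : Type} (F : τ → MvPolynomial σ ℂ) : ProjSpace σ →. ProjSpace τ := fun p =>
  ⟨(fun j => MvPolynomial.eval p.rep (F j)) ≠ 0, fun h => Projectivization.mk ℂ _ h⟩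

/-- The rational map `[v] ↦ [L v]` given by a linear map `L`; it is defined outside of the
projective subspace of the kernel of `L`. For surjective `L` this is the linear projection from
that subspace. -/
def linearProjection {σ τ : Type} (L : (σ → ℂ) →ₗ[ℂ] (τ → ℂ)) : ProjSpace σ →. ProjSpace τ :=
  fun p => ⟨L p.rep ≠ 0, fun h => Projectivization.mk ℂ _ h⟩

/-- The rational maps `f : X ⇢ Y` and `g : Y ⇢ X` are inverse to each other: both compositions
are defined on a (Zariski) dense subset, and equal to the identity wherever they are defined. -/
structure AreInverse {σ τ : Type} (X : Set (ProjSpace σ)) (Y : Set (ProjSpace τ))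
    (f : ProjSpace σ →. ProjSpace τ) (g : ProjSpace τ →. ProjSpace σ) : Prop where
  maps_to : ∀ p ∈ X, ∀ q ∈ f p, q ∈ Y
  maps_from : ∀ q ∈ Y, ∀ p ∈ g q, p ∈ X
  dense_left : X ⊆ zariskiClosure (X ∩ (g.comp f).Dom)
  dense_right : Y ⊆ zariskiClosure (Y ∩ (f.comp g).Dom)
  left_inv : ∀ p ∈ X, ∀ p' ∈ g.comp f p, p' = p
  right_inv : ∀ q ∈ Y, ∀ q' ∈ f.comp g q, q' = q

/-- Dimension of a projective subspace; the empty subspace has dimension `-1`. -/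
def projDim {σ : Type} (W : Projectivization.Subspace ℂ (σ → ℂ)) : ℤ :=
  (Module.finrank ℂ (Projectivization.Subspace.submodule W) : ℤ) - 1

/-! ### Polytopes -/

/-- A full-dimensional convex polytope in `ℝ^n` with `d` facets: the bounded set, with non-empty
interior, of the solutions of `d` inequalities `0 ≤ b i + a i ⬝ x`, none of which can be omitted.
Every full-dimensional convex polytope has such a description, unique up to the order and positive
multiples of the inequalities; they correspond to the facets. -/
structure Polytope (n d : ℕ) where
  a : Fin d → Fin n → ℝ
  b : Fin d → ℝ
  bounded : Bornology.IsBounded {x : Fin n → ℝ | ∀ i, 0 ≤ b i + a i ⬝ᵥ x}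
  full_dim : (interior {x : Fin n → ℝ | ∀ i, 0 ≤ b i + a i ⬝ᵥ x}).Nonempty
  irredundant : ∀ i, ∃ x : Fin n → ℝ, b i + a i ⬝ᵥ x < 0 ∧ ∀ j, j ≠ i → 0 ≤ b j + a j ⬝ᵥ x

namespace Polytope

variable {n d : ℕ} (P : Polytope n d)

/-- The convex polytope as a subset of `ℝ^n`. -/
def body : Set (Fin n → ℝ) := {x | ∀ i, 0 ≤ P.b i + P.a i ⬝ᵥ x}

/-- The `i`-th facet. -/
def facet (i : Fin d) : Set (Fin n → ℝ) := {x ∈ P.body | P.b i + P.a i ⬝ᵥ x = 0}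

/-- The set `V(P)` of vertices. -/
def vertices : Set (Fin n → ℝ) := P.body.extremePoints ℝ

/-- Non-empty faces (among them the polytope itself and the vertices). -/
def IsFace (F : Set (Fin n → ℝ)) : Prop := F.Nonempty ∧ Convex ℝ F ∧ IsExtreme ℝ P.body F

/-- The point `(1 : x_1 : ... : x_n)` of complex projective `n`-space. -/
def toProj (x : Fin n → ℝ) : ProjSpace (Fin (n + 1)) :=
  Projectivization.mk ℂ (Fin.cons 1 (fun k => (x k : ℂ)) : Fin (n + 1) → ℂ)
    (fun h => one_ne_zero (congrFun h 0))

/-- The linear form `ℓ_F` of the hyperplane spanned by the `i`-th facet, homogenized by the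
variable with index `0`. -/
def facetForm (i : Fin d) : MvPolynomial (Fin (n + 1)) ℂ :=
  MvPolynomial.C (P.b i : ℂ) * MvPolynomial.X 0 +
    ∑ k : Fin n, MvPolynomial.C (P.a i k : ℂ) * MvPolynomial.X k.succ

/-- The hyperplane spanned by the `i`-th facet, in complex projective space. -/
def hyperplane (i : Fin d) : Set (ProjSpace (Fin (n + 1))) := {p | VanishesAt (P.facetForm i) p}

/-- The hyperplane arrangement is simple: at most `n` of the hyperplanes pass through any point. -/
def IsSimpleArrangement : Prop :=
  ∀ p : ProjSpace (Fin (n + 1)), {i : Fin d | p ∈ P.hyperplane i}.ncard ≤ n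

/-- The residual arrangement: the union of all intersections of hyperplanes of the arrangement
that do not contain (the Zariski closure of) any face of the polytope. -/
def residualArrangement : Set (ProjSpace (Fin (n + 1))) :=
  {p | ∃ S : Set (Fin d), p ∈ (⋂ i ∈ S, P.hyperplane i) ∧
    ∀ F, P.IsFace F → ¬ zariskiClosure (toProj '' F) ⊆ ⋂ i ∈ S, P.hyperplane i}

/-- The space of homogeneous forms of degree `m` that vanish on the residual arrangement. -/
def residualForms (m : ℕ) : Submodule ℂ (MvPolynomial (Fin (n + 1)) ℂ) where
  carrier := {f | f.IsHomogeneous m ∧ ∀ p ∈ P.residualArrangement, VanishesAt f p}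
  zero_mem' := ⟨MvPolynomial.isHomogeneous_zero _ _ _, fun p _ => by simp [VanishesAt]⟩
  add_mem' := fun {f g} hf hg => ⟨hf.1.add hg.1, fun p hp => by
    have h₁ := hf.2 p hp
    have h₂ := hg.2 p hp
    simp only [VanishesAt] at h₁ h₂ ⊢
    simp [h₁, h₂]⟩
  smul_mem' := fun c f hf => ⟨(MvPolynomial.homogeneousSubmodule (Fin (n + 1)) ℂ m).smul_mem c hf.1,
    fun p hp => by
      have h := hf.2 p hp
      simp only [VanishesAt] at h ⊢
      simp [MvPolynomial.smul_eval, h]⟩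

/-- The adjoint hypersurface `A_P`: the zero locus of the forms of degree `d - n - 1` vanishing on
the residual arrangement (if there is one such form up to scaling, this is its zero locus). -/
def adjointHypersurface : Set (ProjSpace (Fin (n + 1))) :=
  {p | ∀ f ∈ P.residualForms (d - n - 1), VanishesAt f p}

open scoped Classical in
/-- The Wachspress coordinate of a vertex: the product of the linear forms of the facets that do
not contain this vertex. -/
def wachspressForm (u : P.vertices) : MvPolynomial (Fin (n + 1)) ℂ :=
  ∏ i ∈ Finset.univ.filter (fun i => (u : Fin n → ℝ) ∉ P.facet i), P.facetForm i

/-- The Wachspress map `ω_P`. -/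
def wachspressMap : ProjSpace (Fin (n + 1)) →. ProjSpace P.vertices := formsMap P.wachspressForm

/-- The Wachspress variety `W_P`. -/
def wachspressVariety : Set (ProjSpace P.vertices) := zariskiClosure P.wachspressMap.ran

/-- The projective span `V_P` of the image of the adjoint hypersurface under the Wachspress map. -/
def adjointSpan : Projectivization.Subspace ℂ (P.vertices → ℂ) :=
  Projectivization.Subspace.span (P.wachspressMap.image P.adjointHypersurface)

end Polytope

end

end Wachspress

/-!
# The adjoint hypersurface and the inverse of the Wachspress map

Let `ℓ i` be the facet forms of a polytope with simple arrangement, and let `ũ = (1, u)` for a vertex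
`u`. Any `n + 1` of the `ℓ i` have only the origin as a common zero. This gives the interpolation
principle `InGeneralPosition.eq_zero_of_forall_mem_flat`: a form of degree at most `d - k` that
vanishes on all intersections of `k` hyperplanes is zero. Everything rests on its cases `k = n` and
`k = n - 1`.

*Basis.* Each point in which `n` hyperplanes meet is a vertex or a residual point, and the
Wachspress coordinates `ω u` are dual to the vertices. By the case `k = n`, every form of degree
`d - n` that vanishes on the residual arrangement is the combination of the `ω u` given by its values
at the vertices (`eq_sum_wachspressForm`).

*The adjoint.* Let `c u` be the absolute value of the determinant of the facet normals at `u`. On a line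
in which `n - 1` hyperplanes meet, all `ω u` vanish, unless the line carries an edge; then only the two
coordinates of its vertices survive, and the values `c u` are balanced there. Hence the forms
`g k = ∑ u, c u * ũ k • ω u` satisfy `X k * g l = X l * g k` by the case `k = n - 1`
(`X_mul_weightedSum`), so that `g k = X k * α` for a form `α`, the adjoint. It is unique up to scaling,
because a form of degree `d - n - 1` that vanishes on the residual arrangement and in a vertex also
vanishes in the adjacent vertices, and the graph of the polytope is connected
(`forall_vertex_of_adjacent`).

*The inverse.* By construction, the linear map `L : e u ↦ c u • ũ` satisfies `L (ω x) = α x • x`. So it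
inverts the Wachspress map on the complement of the adjoint hypersurface, which is Zariski dense, and the
proportionality of `y` and `ω (L y)` extends to the Zariski closure of the image. It remains to see that
the kernel of `L` is spanned by the image of the adjoint hypersurface, that is, that every linear
relation `∑ u, λ u * ω u = 0` on this hypersurface is a combination of the rows of `L`. As `α` is
squarefree (`squarefree_adjoint`), the Nullstellensatz gives `∑ u, λ u • ω u = α * h` with `h` of degree
at most one, and evaluation at the vertices shows that `λ u = c u * h ũ` (`exists_coeff_eq`).
-/

namespace Wachspress

/-! ### Linear forms in general position -/

section GeneralPosition

variable {K V ι : Type*} [Field K] [AddCommGroup V] [Module K V]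

/-- Any `n + 1` of the linear forms `ℓ i` have no common zero besides the origin. For `V` of
dimension `n + 1` this says that any `n + 1` of them are linearly independent. -/
def InGeneralPosition (n : ℕ) (ℓ : ι → Module.Dual K V) : Prop :=
  ∀ S : Finset ι, n < S.card → ∀ x, (∀ i ∈ S, ℓ i x = 0) → x = 0

/-- The intersection of the hyperplanes `ℓ i = 0` with `i ∈ T`. -/
def flat (ℓ : ι → Module.Dual K V) (T : Finset ι) : Submodule K V where
  carrier := {x | ∀ i ∈ T, ℓ i x = 0}
  zero_mem' := fun i _ => map_zero _
  add_mem' := fun hx hy i hi => by rw [map_add, hx i hi, hy i hi, add_zero]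
  smul_mem' := fun c x hx i hi => by rw [map_smul, hx i hi, smul_zero]

variable [Fintype ι] [FiniteDimensional K V] {n : ℕ} {ℓ : ι → Module.Dual K V}

/-- At most `n + 1` forms in general position take arbitrary values simultaneously. -/
theorem InGeneralPosition.exists_forall_eq (h : InGeneralPosition n ℓ)
    (hV : Module.finrank K V = n + 1) (hι : n + 1 ≤ Fintype.card ι) {U : Finset ι}
    (hU : U.card ≤ n + 1) (y : ι → K) : ∃ x, ∀ i ∈ U, ℓ i x = y i := by
  obtain ⟨W, hUW, hW⟩ := Finset.exists_superset_card_eq hU hι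
  let φ : V →ₗ[K] (W → K) := LinearMap.pi fun i => ℓ i
  have hφ : Function.Injective φ := by
    rw [← LinearMap.ker_eq_bot, LinearMap.ker_eq_bot']
    exact fun x hx => h W (by omega) x fun i hi => congrFun hx ⟨i, hi⟩
  have hs : Function.Surjective φ := by
    rwa [← LinearMap.injective_iff_surjective_of_finrank_eq_finrank]
    simp [hV, hW]
  obtain ⟨x, hx⟩ := hs fun i => y i
  exact ⟨x, fun i hi => congrFun hx ⟨i, hUW hi⟩⟩

variable [Infinite K]

theorem InGeneralPosition.exists_mem_flat_forall_ne_zero (h : InGeneralPosition n ℓ)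
    (hV : Module.finrank K V = n + 1) (hι : n + 1 ≤ Fintype.card ι) {T : Finset ι}
    (hT : T.card ≤ n) : ∃ q ∈ flat ℓ T, ∀ r ∉ T, ℓ r q ≠ 0 := by
  classical
  obtain ⟨q, hq, hq'⟩ := Module.Dual.exists_forall_mem_ne_zero_of_forall_exists (flat ℓ T)
    (fun r : {r // r ∉ T} => ℓ r) (by
      rintro ⟨r, hr⟩
      obtain ⟨x, hx⟩ := h.exists_forall_eq hV hι (U := insert r T)
        ((Finset.card_insert_le _ _).trans (by omega)) (fun i => if i = r then 1 else 0)
      refine ⟨x, fun i hi => ?_, ?_⟩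
      · rw [hx i (Finset.mem_insert_of_mem hi), if_neg (ne_of_mem_of_not_mem hi hr)]
      · simp [hx r (Finset.mem_insert_self _ _)])
  exact ⟨q, hq, fun r hr => hq' ⟨r, hr⟩⟩

/-- Let `p` be a point outside of the hyperplanes with index outside of `T`. For a generic direction
`q` in the flat of `T`, the line `t ↦ p + t • q` meets these hyperplanes in distinct points, none of
which is at infinity. -/
theorem InGeneralPosition.exists_direction (h : InGeneralPosition n ℓ)
    (hV : Module.finrank K V = n + 1) (hι : n + 1 ≤ Fintype.card ι) {T : Finset ι}
    (hT : T.card + 1 ≤ n) {p : V} (hp : ∀ r ∉ T, ℓ r p ≠ 0) :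
    ∃ q ∈ flat ℓ T, (∀ r ∉ T, ℓ r q ≠ 0) ∧
      ∀ r ∉ T, ∀ s ∉ T, r ≠ s → ℓ r p * ℓ s q ≠ ℓ s p * ℓ r q := by
  classical
  obtain ⟨q, hq, hq'⟩ := Module.Dual.exists_forall_mem_ne_zero_of_forall_exists (flat ℓ T)
    (fun r : {r : ι × ι // r.1 ∉ T ∧ r.2 ∉ T} =>
      if r.1.1 = r.1.2 then ℓ r.1.1 else ℓ r.1.1 p • ℓ r.1.2 - ℓ r.1.2 p • ℓ r.1.1) (by
      rintro ⟨⟨r, s⟩, hr, hs⟩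
      dsimp only at hr hs ⊢
      obtain ⟨x, hx⟩ := h.exists_forall_eq hV hι (U := insert r (insert s T))
        ((Finset.card_insert_le _ _).trans (by
          have := Finset.card_insert_le s T
          omega)) (fun i => if i = r then 1 else 0)
      refine ⟨x, fun i hi => ?_, ?_⟩
      · rw [hx i (by simp [hi]), if_neg (ne_of_mem_of_not_mem hi hr)]
      · have h1 := hx r (by simp)
        have h2 := hx s (by simp)
        split_ifs with hrs
        · simp [h1]
        · simp [h1, h2, Ne.symm hrs, hp s hs])
  refine ⟨q, hq, fun r hr => ?_, fun r hr s hs hrs => ?_⟩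
  · simpa using hq' ⟨(r, r), hr, hr⟩
  · simpa [hrs, sub_eq_zero] using hq' ⟨(r, s), hr, hs⟩

end GeneralPosition

/-! ### Restriction of polynomials to lines and flats -/

section Lines

variable {K σ ι : Type*} [Field K]

/-- The restriction of a polynomial to the parametrized line `t ↦ p + t • q`. -/
noncomputable def restrictLine (p q : σ → K) : MvPolynomial σ K →ₐ[K] Polynomial K :=
  MvPolynomial.aeval fun k => Polynomial.C (p k) + Polynomial.C (q k) * Polynomial.X

theorem eval_restrictLine (p q : σ → K) (f : MvPolynomial σ K) (t : K) :
    (restrictLine p q f).eval t = MvPolynomial.eval (p + t • q) f := by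
  have : ((Polynomial.aeval t).comp (restrictLine p q)) f = MvPolynomial.aeval (p + t • q) f := by
    congr 1
    ext k
    simp [restrictLine, -Polynomial.X_mul_C, mul_comm t]
  simpa [MvPolynomial.aeval_eq_eval] using this

theorem natDegree_restrictLine_le (p q : σ → K) (f : MvPolynomial σ K) :
    (restrictLine p q f).natDegree ≤ f.totalDegree := by
  have h := MvPolynomial.aeval_natDegree_le (n := 1) f le_rfl
    (fun k => Polynomial.C (p k) + Polynomial.C (q k) * Polynomial.X) (fun k => by compute_degree)
  rwa [mul_one] at h

variable [Infinite K] [Fintype ι] [Fintype σ] {n : ℕ} {ℓ : ι → Module.Dual K (σ → K)}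

/-- A polynomial of degree at most `d - k` that vanishes on all intersections of `k` out of `d`
hyperplanes in general position vanishes identically. Indeed, a generic line in the intersection of
`k - 1` hyperplanes meets the other ones in `d - k + 1` distinct points, so the polynomial also
vanishes on the intersections of `k - 1` hyperplanes, and so on. -/
theorem InGeneralPosition.eq_zero_of_forall_mem_flat (h : InGeneralPosition n ℓ)
    (hσ : Fintype.card σ = n + 1) (hι : n + 1 ≤ Fintype.card ι) {f : MvPolynomial σ K} {k : ℕ}
    (hk : k ≤ n) (hf : f.totalDegree + k ≤ Fintype.card ι)
    (H : ∀ T : Finset ι, T.card = k → ∀ x ∈ flat ℓ T, MvPolynomial.eval x f = 0) : f = 0 := by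
  classical
  have hV : Module.finrank K (σ → K) = n + 1 := by simp [hσ]
  induction k with
  | zero =>
    refine MvPolynomial.funext fun x => ?_
    rw [map_zero]
    exact H ∅ rfl x fun i hi => absurd hi (Finset.notMem_empty i)
  | succ k ih =>
    refine ih (by omega) (by omega) fun T hT p hp => ?_
    by_cases hpT : ∀ r ∉ T, ℓ r p ≠ 0
    · obtain ⟨q, hq, hq0, hqq⟩ := h.exists_direction hV hι (by omega) hpT
      suffices hz : restrictLine p q f = 0 by
        simpa [hz] using (eval_restrictLine p q f 0).symm
      refine Polynomial.eq_zero_of_natDegree_lt_card_of_eval_eq_zero _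
        (f := fun r : {r // r ∈ Tᶜ} => -(ℓ r p / ℓ r q)) ?_ ?_ ?_
      · rintro ⟨r, hr⟩ ⟨s, hs⟩ hrs
        rw [Finset.mem_compl] at hr hs
        by_contra hne
        refine hqq r hr s hs (fun e => hne (Subtype.ext e)) ?_
        have h1 := hq0 r hr
        have h2 := hq0 s hs
        have h3 := neg_injective hrs
        dsimp only at h3
        field_simp at h3
        linear_combination h3
      · rintro ⟨r, hr⟩
        rw [Finset.mem_compl] at hr
        rw [eval_restrictLine]
        refine H (insert r T) (by rw [Finset.card_insert_of_notMem hr, hT]) _ fun i hi => ?_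
        rcases Finset.mem_insert.1 hi with rfl | hi
        · have := hq0 i hr
          simp [this]
        · simp [hp i hi, hq i hi]
      · refine (natDegree_restrictLine_le _ _ _).trans_lt ?_
        rw [Fintype.card_coe, Finset.card_compl, hT]
        omega
    · push Not at hpT
      obtain ⟨r, hr, hrp⟩ := hpT
      refine H (insert r T) (by rw [Finset.card_insert_of_notMem hr, hT]) p fun i hi => ?_
      rcases Finset.mem_insert.1 hi with rfl | hi
      exacts [hrp, hp i hi]

end Lines

/-! ### Homogeneous forms on projective space -/

theorem eval_smul_of_isHomogeneous {σ K : Type*} [Fintype σ] [Field K] {f : MvPolynomial σ K}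
    {m : ℕ} (hf : f.IsHomogeneous m) (c : K) (x : σ → K) :
    MvPolynomial.eval (c • x) f = c ^ m * MvPolynomial.eval x f := by
  simp only [MvPolynomial.eval_eq', Finset.mul_sum]
  refine Finset.sum_congr rfl fun s hs => ?_
  have h : ∑ i, s i = m := by
    rw [← Finsupp.degree_eq_sum]
    by_contra hne
    exact MvPolynomial.mem_support_iff.1 hs (hf.coeff_eq_zero hne)
  simp only [Pi.smul_apply, smul_eq_mul, mul_pow, Finset.prod_mul_distrib,
    Finset.prod_pow_eq_pow_sum, h]
  ring

theorem vanishesAt_mk {σ : Type} [Fintype σ] {f : MvPolynomial σ ℂ} {m : ℕ}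
    (hf : f.IsHomogeneous m) {x : σ → ℂ} (hx : x ≠ 0) :
    VanishesAt f (Projectivization.mk ℂ x hx) ↔ MvPolynomial.eval x f = 0 := by
  obtain ⟨c, hc⟩ := Projectivization.exists_smul_eq_mk_rep ℂ x hx
  rw [VanishesAt, ← hc, Units.smul_def, eval_smul_of_isHomogeneous hf, mul_eq_zero,
    or_iff_right (pow_ne_zero _ c.ne_zero)]

namespace Polytope

/-! ### The arrangement of facet hyperplanes -/

variable {n d : ℕ} (P : Polytope n d)

/-- The value at `x` of the affine function that defines the `i`-th facet. -/
def slack (i : Fin d) (x : Fin n → ℝ) : ℝ := P.b i + P.a i ⬝ᵥ x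

open scoped Classical in
/-- The indices of the facet hyperplanes through `x`. -/
noncomputable def tight (x : Fin n → ℝ) : Finset (Fin d) :=
  Finset.univ.filter fun i => P.slack i x = 0

/-- The linear form that `P.facetForm i` represents. -/
def facetDual (i : Fin d) : Module.Dual ℂ (Fin (n + 1) → ℂ) :=
  (P.b i : ℂ) • LinearMap.proj 0 + ∑ k : Fin n, (P.a i k : ℂ) • LinearMap.proj k.succ

/-- The vector `(1, x)` of homogeneous coordinates of the point `x`. -/
def homogenize (x : Fin n → ℝ) : Fin (n + 1) → ℂ := Fin.cons 1 fun k => (x k : ℂ)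

theorem facetDual_apply (i : Fin d) (x : Fin (n + 1) → ℂ) :
    P.facetDual i x = P.b i * x 0 + ∑ k : Fin n, P.a i k * x k.succ := by
  simp [facetDual]

theorem eval_facetForm (i : Fin d) (x : Fin (n + 1) → ℂ) :
    MvPolynomial.eval x (P.facetForm i) = P.facetDual i x := by
  simp [facetForm, facetDual_apply]

theorem facetForm_isHomogeneous (i : Fin d) : (P.facetForm i).IsHomogeneous 1 :=
  (MvPolynomial.isHomogeneous_C_mul_X _ _).add
    (MvPolynomial.IsHomogeneous.sum _ _ _ fun _ _ => MvPolynomial.isHomogeneous_C_mul_X _ _)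

theorem homogenize_ne_zero (x : Fin n → ℝ) : homogenize x ≠ 0 :=
  fun h => one_ne_zero (congrFun h 0)

@[simp] theorem homogenize_zero (x : Fin n → ℝ) : homogenize x 0 = 1 := rfl

theorem facetDual_homogenize (i : Fin d) (x : Fin n → ℝ) :
    P.facetDual i (homogenize x) = (P.slack i x : ℂ) := by
  simp [facetDual_apply, homogenize, slack, dotProduct]

theorem mem_tight {i : Fin d} {x : Fin n → ℝ} : i ∈ P.tight x ↔ P.slack i x = 0 := by
  simp [tight]

theorem mem_body {x : Fin n → ℝ} : x ∈ P.body ↔ ∀ i, 0 ≤ P.slack i x := Iff.rfl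

theorem slack_add_smul (i : Fin d) (x e : Fin n → ℝ) (t : ℝ) :
    P.slack i (x + t • e) = P.slack i x + t * (P.a i ⬝ᵥ e) := by
  simp only [slack, dotProduct_add, dotProduct_smul, smul_eq_mul]
  ring

theorem dotProduct_sub_eq (i : Fin d) (x y : Fin n → ℝ) :
    P.a i ⬝ᵥ (x - y) = P.slack i x - P.slack i y := by
  simp only [slack, dotProduct_sub]
  ring

theorem continuous_slack (i : Fin d) : Continuous (P.slack i) := by
  unfold slack dotProduct
  fun_prop

variable {P} in
theorem IsSimpleArrangement.inGeneralPosition (hP : P.IsSimpleArrangement) :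
    InGeneralPosition n P.facetDual := by
  intro S hS x hx
  by_contra hx0
  have h := hP (Projectivization.mk ℂ x hx0)
  have hsub : (S : Set (Fin d)) ⊆ {i | Projectivization.mk ℂ x hx0 ∈ P.hyperplane i} :=
    fun i hi => (vanishesAt_mk (P.facetForm_isHomogeneous i) hx0).2
      ((P.eval_facetForm i x).trans (hx i hi))
  have := Set.ncard_le_ncard hsub (Set.toFinite _)
  rw [Set.ncard_coe_finset] at this
  omega

theorem nonempty_body : P.body.Nonempty := P.full_dim.mono interior_subset

theorem isClosed_body : IsClosed P.body := by
  have : P.body = ⋂ i, {x | 0 ≤ P.slack i x} := by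
    ext x
    simp [mem_body]
  rw [this]
  exact isClosed_iInter fun i => isClosed_le continuous_const (P.continuous_slack i)

theorem isCompact_body : IsCompact P.body :=
  Metric.isCompact_of_isClosed_isBounded P.isClosed_body P.bounded

/-- The recession cone of a polytope is trivial. -/
theorem eq_zero_of_forall_dotProduct_nonneg {e : Fin n → ℝ} (he : ∀ i, 0 ≤ P.a i ⬝ᵥ e) : e = 0 := by
  obtain ⟨x, hx⟩ := P.nonempty_body
  obtain ⟨R, hR⟩ := P.bounded.exists_norm_le
  by_contra hne
  have hpos : 0 < ‖e‖ := norm_pos_iff.2 hne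
  have hR0 : 0 ≤ R := (norm_nonneg x).trans (hR x hx)
  have ht : 0 ≤ (2 * R + 1) / ‖e‖ := by positivity
  have hmem : x + ((2 * R + 1) / ‖e‖) • e ∈ P.body := P.mem_body.2 fun i => by
    rw [slack_add_smul]
    exact add_nonneg (hx i) (mul_nonneg ht (he i))
  have h1 := hR _ hmem
  have h2 := norm_sub_le (x + ((2 * R + 1) / ‖e‖) • e) x
  rw [add_sub_cancel_left, norm_smul, Real.norm_of_nonneg ht, div_mul_cancel₀ _ hpos.ne'] at h2
  linarith [hR x hx]

theorem lt_card_facets (P : Polytope n d) (hn : 0 < n) : n < d := by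
  by_contra hle
  let A : (Fin n → ℝ) →ₗ[ℝ] (Fin d → ℝ) := Matrix.mulVecLin (Matrix.of P.a)
  by_cases hinj : Function.Injective A
  · have hnd : n = d := le_antisymm (by simpa using LinearMap.finrank_le_finrank_of_injective hinj)
      (not_lt.1 hle)
    obtain ⟨e, he⟩ := (LinearMap.injective_iff_surjective_of_finrank_eq_finrank
      (by simpa using hnd)).1 hinj fun _ => 1
    have he' : ∀ i, P.a i ⬝ᵥ e = 1 := fun i => congrFun he i
    have := P.eq_zero_of_forall_dotProduct_nonneg fun i => (he' i).symm ▸ zero_le_one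
    simpa [this] using he' ⟨0, hnd ▸ hn⟩
  · obtain ⟨e, he, hne⟩ := (Submodule.ne_bot_iff _).1 (mt LinearMap.ker_eq_bot.1 hinj)
    exact hne (P.eq_zero_of_forall_dotProduct_nonneg fun i => (congrFun he i).ge)

variable {P}

/-- If `n` facet hyperplanes pass through a point, their normal vectors have trivial common
orthogonal complement. -/
theorem IsSimpleArrangement.eq_zero_of_dotProduct (hP : P.IsSimpleArrangement) (hn : 0 < n)
    {S : Finset (Fin d)} (hS : S.card = n) {u e : Fin n → ℝ} (hu : ∀ i ∈ S, P.slack i u = 0)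
    (he : ∀ i ∈ S, P.a i ⬝ᵥ e = 0) : e = 0 := by
  classical
  obtain ⟨j, hj⟩ : ∃ j, j ∉ S := by
    by_contra! h
    have := P.lt_card_facets hn
    rw [Finset.eq_univ_iff_forall.2 h, Finset.card_univ, Fintype.card_fin] at hS
    omega
  -- the points `(1, u)` and `(0, e)` both lie in the intersection of the `n` hyperplanes
  let x : Fin (n + 1) → ℂ := Fin.cons 0 fun k => (e k : ℂ)
  have hx : ∀ i, P.facetDual i x = ((P.a i ⬝ᵥ e : ℝ) : ℂ) := fun i => by
    simp [facetDual_apply, x, dotProduct]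
  have hcard : n < (insert j S).card := by rw [Finset.card_insert_of_notMem hj]; omega
  have hju : P.facetDual j (homogenize u) ≠ 0 := fun h0 =>
    homogenize_ne_zero u <| hP.inGeneralPosition _ hcard _ fun i hi => by
      rcases Finset.mem_insert.1 hi with rfl | hi
      · exact h0
      · rw [facetDual_homogenize, hu i hi, Complex.ofReal_zero]
  have hz := hP.inGeneralPosition _ hcard
    (x - (P.facetDual j x / P.facetDual j (homogenize u)) • homogenize u) fun i hi => by
      rcases Finset.mem_insert.1 hi with rfl | hi
      · simp [hju]
      · simp [facetDual_homogenize, hu i hi, hx, he i hi]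
  have h0 : P.facetDual j x / P.facetDual j (homogenize u) = 0 := by
    simpa [x] using congrFun hz 0
  rw [h0, zero_smul, sub_zero] at hz
  ext k
  simpa [x] using congrFun hz k.succ

/-! ### Vertices and edges of a simple polytope -/

theorem slack_nonneg {x : Fin n → ℝ} (hx : x ∈ P.body) (i : Fin d) : 0 ≤ P.slack i x := hx i

theorem slack_pos {x : Fin n → ℝ} (hx : x ∈ P.body) {i : Fin d} (hi : i ∉ P.tight x) :
    0 < P.slack i x :=
  lt_of_le_of_ne (hx i) fun h => hi (P.mem_tight.2 h.symm)

/-- From a point of the polytope one can move a little in every direction along which the slacks of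
the tight inequalities do not decrease. -/
theorem exists_pos_add_smul_mem_body {x e : Fin n → ℝ} (hx : x ∈ P.body)
    (he : ∀ i ∈ P.tight x, 0 ≤ P.a i ⬝ᵥ e) : ∃ ε : ℝ, 0 < ε ∧ x + ε • e ∈ P.body := by
  have h : ∀ᶠ ε : ℝ in nhdsWithin 0 (Set.Ioi 0), ∀ i, 0 ≤ P.slack i (x + ε • e) := by
    rw [Filter.eventually_all]
    intro i
    by_cases hi : i ∈ P.tight x
    · filter_upwards [self_mem_nhdsWithin] with ε hε
      rw [slack_add_smul]
      exact add_nonneg (hx i) (mul_nonneg (Set.mem_Ioi.1 hε).le (he i hi))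
    · have hc : Continuous fun ε : ℝ => P.slack i (x + ε • e) :=
        (P.continuous_slack i).comp (by fun_prop)
      have h0 : 0 < P.slack i (x + (0 : ℝ) • e) := by simpa using slack_pos hx hi
      filter_upwards [nhdsWithin_le_nhds (hc.continuousAt.eventually (lt_mem_nhds h0))] with ε hε
      exact hε.le
  obtain ⟨ε, h1, h2⟩ := (h.and self_mem_nhdsWithin).exists
  exact ⟨ε, h2, h1⟩

theorem slack_eq_zero_of_mem_openSegment {i : Fin d} {x y z : Fin n → ℝ} (hx : 0 ≤ P.slack i x)
    (hy : 0 ≤ P.slack i y) (hz : z ∈ openSegment ℝ x y) (h : P.slack i z = 0) :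
    P.slack i x = 0 ∧ P.slack i y = 0 := by
  obtain ⟨s, t, hs, ht, hst, rfl⟩ := hz
  have : P.slack i (s • x + t • y) = s * P.slack i x + t * P.slack i y := by
    simp only [slack, dotProduct_add, dotProduct_smul, smul_eq_mul]
    linear_combination (-P.b i) * hst
  rw [this] at h
  have h1 := mul_nonneg hs.le hx
  have h2 := mul_nonneg ht.le hy
  constructor
  · exact (mul_eq_zero.1 (by linarith)).resolve_left hs.ne'
  · exact (mul_eq_zero.1 (by linarith)).resolve_left ht.ne'

theorem vertices_subset_body : P.vertices ⊆ P.body := extremePoints_subset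

theorem IsSimpleArrangement.card_tight_le (hP : P.IsSimpleArrangement) (x : Fin n → ℝ) :
    (P.tight x).card ≤ n := by
  by_contra! h
  refine homogenize_ne_zero x (hP.inGeneralPosition _ h _ fun i hi => ?_)
  rw [facetDual_homogenize, P.mem_tight.1 hi, Complex.ofReal_zero]

/-- Every point of the polytope with `n` tight inequalities is a vertex. -/
theorem IsSimpleArrangement.mem_vertices_of_le_card (hP : P.IsSimpleArrangement) (hn : 0 < n)
    {u : Fin n → ℝ} (hu : u ∈ P.body) (hcard : n ≤ (P.tight u).card) : u ∈ P.vertices := by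
  rw [vertices, mem_extremePoints_iff_left]
  refine ⟨hu, fun x hx y hy hxy => ?_⟩
  have hS := le_antisymm (hP.card_tight_le u) hcard
  refine sub_eq_zero.1 (hP.eq_zero_of_dotProduct hn hS (fun i hi => P.mem_tight.1 hi) fun i hi => ?_)
  rw [dotProduct_sub_eq, P.mem_tight.1 hi,
    (slack_eq_zero_of_mem_openSegment (hx i) (hy i) hxy (P.mem_tight.1 hi)).1, sub_zero]

theorem le_card_tight_of_mem_vertices {u : Fin n → ℝ} (hu : u ∈ P.vertices) :
    n ≤ (P.tight u).card := by
  by_contra! hlt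
  let A : (Fin n → ℝ) →ₗ[ℝ] (P.tight u → ℝ) :=
    Matrix.mulVecLin (Matrix.of fun i : P.tight u => P.a i)
  obtain ⟨e, he, hne⟩ := (Submodule.ne_bot_iff _).1
    (A.ker_ne_bot_of_finrank_lt (by simpa using hlt))
  have he' : ∀ i ∈ P.tight u, P.a i ⬝ᵥ e = 0 := fun i hi => congrFun he ⟨i, hi⟩
  have hub := vertices_subset_body hu
  obtain ⟨s, hs, hs'⟩ := exists_pos_add_smul_mem_body hub fun i hi => (he' i hi).ge
  obtain ⟨t, ht, ht'⟩ := exists_pos_add_smul_mem_body (e := -e) hub fun i hi => by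
    rw [dotProduct_neg, he' i hi, neg_zero]
  have hst : s + t ≠ 0 := (add_pos hs ht).ne'
  have h := (mem_extremePoints_iff_left.1 hu).2 _ hs' _ ht'
    ⟨t / (s + t), s / (s + t), by positivity, by positivity, by field_simp; ring, by
      ext k
      simp only [Pi.add_apply, Pi.smul_apply, Pi.neg_apply, smul_eq_mul]
      field_simp
      ring⟩
  simp only [add_eq_left, smul_eq_zero, hs.ne', false_or] at h
  exact hne h

theorem IsSimpleArrangement.card_tight (hP : P.IsSimpleArrangement) {u : Fin n → ℝ}
    (hu : u ∈ P.vertices) : (P.tight u).card = n :=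
  le_antisymm (hP.card_tight_le u) (le_card_tight_of_mem_vertices hu)

theorem IsSimpleArrangement.eq_of_tight_subset (hP : P.IsSimpleArrangement) (hn : 0 < n)
    {u v : Fin n → ℝ} (hu : u ∈ P.vertices) (h : P.tight u ⊆ P.tight v) : v = u := by
  refine sub_eq_zero.1 (hP.eq_zero_of_dotProduct hn (hP.card_tight hu)
    (fun i hi => P.mem_tight.1 hi) fun i hi => ?_)
  rw [dotProduct_sub_eq, P.mem_tight.1 hi, P.mem_tight.1 (h hi), sub_zero]

theorem IsSimpleArrangement.finite_vertices (hP : P.IsSimpleArrangement) (hn : 0 < n) :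
    P.vertices.Finite :=
  Set.Finite.of_finite_image (f := P.tight) (Set.toFinite _) fun _ hu _ _ h =>
    (hP.eq_of_tight_subset hn hu h.subset).symm

/-- Every non-empty face contains a vertex. -/
theorem exists_vertex_tight_subset {x : Fin n → ℝ} (hx : x ∈ P.body) :
    ∃ u ∈ P.vertices, P.tight x ⊆ P.tight u := by
  let G : Set (Fin n → ℝ) := P.body ∩ ⋂ i ∈ P.tight x, {y | P.slack i y = 0}
  have hG : IsCompact G := P.isCompact_body.inter_right <|
    isClosed_biInter fun i _ => isClosed_eq (P.continuous_slack i) continuous_const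
  obtain ⟨u, hu⟩ := hG.extremePoints_nonempty
    ⟨x, hx, Set.mem_iInter₂.2 fun i hi => P.mem_tight.1 hi⟩
  have hext : IsExtreme ℝ P.body G :=
    ⟨Set.inter_subset_left, fun y hy z hz w hw hyz => ⟨hy, Set.mem_iInter₂.2 fun i hi =>
      (slack_eq_zero_of_mem_openSegment (hy i) (hz i) hyz (Set.mem_iInter₂.1 hw.2 i hi)).1⟩⟩
  exact ⟨u, hext.extremePoints_subset_extremePoints hu, fun i hi =>
    P.mem_tight.2 (Set.mem_iInter₂.1 (extremePoints_subset hu).2 i hi)⟩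

theorem nonempty_vertices : P.vertices.Nonempty := by
  obtain ⟨x, hx⟩ := P.nonempty_body
  obtain ⟨u, hu, -⟩ := exists_vertex_tight_subset hx
  exact ⟨u, hu⟩

/-- From a vertex `u` on the facet `j`, an edge leads away from this facet. It ends in a vertex that
shares with `u` all facets through `u` except for `j`. -/
theorem IsSimpleArrangement.exists_adjacent (hP : P.IsSimpleArrangement) (hn : 0 < n)
    {u : Fin n → ℝ} (hu : u ∈ P.vertices) {j : Fin d} (hj : j ∈ P.tight u) :
    ∃ v ∈ P.vertices, (P.tight u).erase j ⊆ P.tight v ∧ 0 < P.slack j v := by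
  have hub := vertices_subset_body hu
  have hcard := hP.card_tight hu
  let A : (Fin n → ℝ) →ₗ[ℝ] (P.tight u → ℝ) :=
    Matrix.mulVecLin (Matrix.of fun i : P.tight u => P.a i)
  have hA : Function.Injective A := by
    rw [← LinearMap.ker_eq_bot, LinearMap.ker_eq_bot']
    exact fun e he => hP.eq_zero_of_dotProduct hn hcard (fun i hi => P.mem_tight.1 hi)
      fun i hi => congrFun he ⟨i, hi⟩
  obtain ⟨e, he⟩ := (LinearMap.injective_iff_surjective_of_finrank_eq_finrank
    (by simp [hcard])).1 hA fun i => if (i : Fin d) = j then 1 else 0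
  have he' : ∀ i ∈ P.tight u, P.a i ⬝ᵥ e = if i = j then 1 else 0 :=
    fun i hi => congrFun he ⟨i, hi⟩
  obtain ⟨s, hs, hs'⟩ := exists_pos_add_smul_mem_body (e := e) hub fun i hi => by
    rw [he' i hi]
    split_ifs <;> norm_num
  -- the end point of the edge maximizes the slack of `j`
  let G : Set (Fin n → ℝ) := P.body ∩ ⋂ i ∈ (P.tight u).erase j, {y | P.slack i y = 0}
  have hG : IsCompact G := P.isCompact_body.inter_right <|
    isClosed_biInter fun i _ => isClosed_eq (P.continuous_slack i) continuous_const
  have hsG : u + s • e ∈ G := ⟨hs', Set.mem_iInter₂.2 fun i hi => by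
    have := Finset.mem_erase.1 hi
    change P.slack i (u + s • e) = 0
    rw [slack_add_smul, P.mem_tight.1 this.2, he' i this.2, if_neg this.1, mul_zero, add_zero]⟩
  obtain ⟨v, hv, hmax⟩ := hG.exists_isMaxOn ⟨_, hsG⟩ (P.continuous_slack j).continuousOn
  have hvT : (P.tight u).erase j ⊆ P.tight v := fun i hi =>
    P.mem_tight.2 (Set.mem_iInter₂.1 hv.2 i hi)
  have hvj : 0 < P.slack j v := by
    have h1 : P.slack j (u + s • e) ≤ P.slack j v := hmax hsG
    rw [slack_add_smul, P.mem_tight.1 hj, he' j hj, if_pos rfl] at h1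
    linarith
  refine ⟨v, hP.mem_vertices_of_le_card hn hv.1 ?_, hvT, hvj⟩
  -- otherwise one can move on beyond `v`
  by_contra! hlt
  have hT : P.tight v = (P.tight u).erase j := by
    refine (Finset.eq_of_subset_of_card_le hvT ?_).symm
    rw [Finset.card_erase_of_mem hj]
    omega
  have hdir : ∀ i ∈ (P.tight u).erase j, P.a i ⬝ᵥ (v - u) = 0 := fun i hi => by
    rw [dotProduct_sub_eq, P.mem_tight.1 (hvT hi), P.mem_tight.1 (Finset.mem_of_mem_erase hi),
      sub_zero]
  obtain ⟨t, ht, ht'⟩ := exists_pos_add_smul_mem_body (e := v - u) hv.1 fun i hi =>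
    (hdir i (hT ▸ hi)).ge
  have h1 : P.slack j (v + t • (v - u)) ≤ P.slack j v := hmax ⟨ht', Set.mem_iInter₂.2 fun i hi => by
    change P.slack i (v + t • (v - u)) = 0
    rw [slack_add_smul, P.mem_tight.1 (hvT hi), hdir i hi, mul_zero, add_zero]⟩
  rw [slack_add_smul, dotProduct_sub_eq, P.mem_tight.1 hj] at h1
  nlinarith

/-- An edge has only two vertices. -/
theorem IsSimpleArrangement.eq_of_erase_subset (hP : P.IsSimpleArrangement) (hn : 0 < n)
    {u v w : Fin n → ℝ} (hu : u ∈ P.vertices) {j : Fin d} (hj : j ∈ P.tight u)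
    (hv : v ∈ P.vertices) (hvT : (P.tight u).erase j ⊆ P.tight v) (hvj : 0 < P.slack j v)
    (hw : w ∈ P.vertices) (hwT : (P.tight u).erase j ⊆ P.tight w) (hwu : w ≠ u) : w = v := by
  have hwj : 0 < P.slack j w := slack_pos (vertices_subset_body hw) fun hjw =>
    hwu <| hP.eq_of_tight_subset hn hu <| by
      rw [← Finset.insert_erase hj]
      exact Finset.insert_subset hjw hwT
  -- on the line of the edge, the slack of `j` serves as a coordinate
  have key : ∀ {x y : Fin n → ℝ}, y ∈ P.vertices → (P.tight u).erase j ⊆ P.tight x →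
      (P.tight u).erase j ⊆ P.tight y → x ∈ P.body → 0 < P.slack j y →
      P.slack j y ≤ P.slack j x → y = x := by
    intro x y hy hxT hyT hx hyj hyx
    have hxj : 0 < P.slack j x := hyj.trans_le hyx
    have hline : y - (u + (P.slack j y / P.slack j x) • (x - u)) = 0 := by
      refine hP.eq_zero_of_dotProduct hn (hP.card_tight hu) (fun i hi => P.mem_tight.1 hi)
        fun i hi => ?_
      rw [dotProduct_sub_eq, slack_add_smul, dotProduct_sub_eq, P.mem_tight.1 hi]
      by_cases hij : i = j
      · subst hij
        field_simp
        ring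
      · have hi' := Finset.mem_erase.2 ⟨hij, hi⟩
        rw [P.mem_tight.1 (hyT hi'), P.mem_tight.1 (hxT hi')]
        ring
    rcases hyx.eq_or_lt with h | h
    · rw [h, div_self hxj.ne', one_smul] at hline
      simpa [sub_eq_zero] using hline
    · have hmem : y ∈ openSegment ℝ u x := by
        refine ⟨1 - P.slack j y / P.slack j x, P.slack j y / P.slack j x, ?_, by positivity,
          by ring, ?_⟩
        · rw [sub_pos, div_lt_one hxj]
          exact h
        · generalize P.slack j y / P.slack j x = ρ at hline
          rw [sub_eq_zero.1 hline]
          module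
      have := ((mem_extremePoints.1 hy).2 _ (vertices_subset_body hu) _ hx hmem).2
      exact this.symm
  rcases le_total (P.slack j w) (P.slack j v) with h | h
  · exact key hw hvT hwT (vertices_subset_body hv) hwj h
  · exact (key hv hwT hvT (vertices_subset_body hw) hvj h).symm

/-- The graph of the polytope is connected: a set of vertices that is closed under passing to
adjacent vertices contains all of them. As in the simplex method, one decreases a linear function
that has its minimum in the desired vertex `w` only. -/
theorem IsSimpleArrangement.forall_vertex_of_adjacent (hP : P.IsSimpleArrangement) (hn : 0 < n)
    {p : (Fin n → ℝ) → Prop} (h0 : ∃ u ∈ P.vertices, p u)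
    (hp : ∀ u ∈ P.vertices, p u → ∀ j ∈ P.tight u, ∀ v ∈ P.vertices,
      (P.tight u).erase j ⊆ P.tight v → 0 < P.slack j v → p v) :
    ∀ w ∈ P.vertices, p w := by
  intro w hw
  let K : Set (Fin n → ℝ) := {u | u ∈ P.vertices ∧ p u}
  let φ : (Fin n → ℝ) → ℝ := fun x => ∑ i ∈ P.tight w, P.slack i x
  obtain ⟨u, ⟨hu, hpu⟩, hmin⟩ := Set.exists_min_image K φ
    ((hP.finite_vertices hn).subset fun x hx => hx.1) h0
  by_contra hwp
  have hwu : w ≠ u := fun h => hwp (h ▸ hpu)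
  have hub := vertices_subset_body hu
  have hwb := vertices_subset_body hw
  choose! v hv hvT hvj using fun j (hj : j ∈ P.tight u) => hP.exists_adjacent hn hu hj
  -- `w` lies in the cone that is spanned by the edges at `u`
  have hcone : w - u - ∑ j ∈ P.tight u, (P.slack j w / P.slack j (v j)) • (v j - u) = 0 := by
    refine hP.eq_zero_of_dotProduct hn (hP.card_tight hu) (fun i hi => P.mem_tight.1 hi)
      fun i hi => ?_
    rw [dotProduct_sub, dotProduct_sub_eq, P.mem_tight.1 hi, dotProduct_sum,
      Finset.sum_eq_single_of_mem i hi]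
    · rw [dotProduct_smul, dotProduct_sub_eq, P.mem_tight.1 hi, sub_zero, sub_zero,
        smul_eq_mul, div_mul_cancel₀ _ (hvj i hi).ne', sub_self]
    · intro j hj hji
      rw [dotProduct_smul, dotProduct_sub_eq, P.mem_tight.1 hi,
        P.mem_tight.1 (hvT j hj (Finset.mem_erase.2 ⟨hji.symm, hi⟩)), sub_zero, smul_zero]
  have hφ : ∀ x, ∑ i ∈ P.tight w, P.a i ⬝ᵥ (x - u) = φ x - φ u := fun x => by
    simp only [dotProduct_sub_eq, Finset.sum_sub_distrib, φ]
  have hφw : φ w = 0 := Finset.sum_eq_zero fun i hi => P.mem_tight.1 hi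
  have hφu : 0 < φ u := by
    refine (Finset.sum_nonneg fun i _ => hub i).lt_of_ne fun h => hwu ?_
    refine (hP.eq_of_tight_subset hn hw fun i hi => P.mem_tight.2 ?_).symm
    exact (Finset.sum_eq_zero_iff_of_nonneg fun i _ => hub i).1 h.symm i hi
  have hsum : φ w - φ u =
      ∑ j ∈ P.tight u, P.slack j w / P.slack j (v j) * (φ (v j) - φ u) := by
    rw [← hφ, sub_eq_zero.1 hcone]
    simp only [dotProduct_sum, dotProduct_smul, ← hφ, smul_eq_mul, Finset.mul_sum]
    exact Finset.sum_comm
  have : 0 ≤ φ w - φ u := by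
    rw [hsum]
    exact Finset.sum_nonneg fun j hj => mul_nonneg (div_nonneg (hwb j) (hvj j hj).le)
      (sub_nonneg.2 (hmin _ ⟨hv j hj, hp u hu hpu j hj _ (hv j hj) (hvT j hj) (hvj j hj)⟩))
  linarith

/-! ### The weight of a vertex -/

/-- The determinant `det M` of the matrix `M` with rows `a i`, `i ∈ S`, up to sign. It is encoded as
the square root of `det (Mᵀ * M)`, which does not refer to an order of the rows. -/
noncomputable def normalVolume (P : Polytope n d) (S : Finset (Fin d)) : ℝ :=
  Real.sqrt (∑ i ∈ S, Matrix.vecMulVec (P.a i) (P.a i)).det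

theorem normalVolume_eq_abs_det (P : Polytope n d) {S : Finset (Fin d)} {f : Fin n → Fin d}
    (hf : Function.Injective f) (hS : Set.range f = S) :
    P.normalVolume S = |(Matrix.of fun k => P.a (f k)).det| := by
  classical
  have hS' : S = Finset.univ.image f := by
    ext i
    rw [← Finset.mem_coe, ← hS]
    simp
  have h : ∑ i ∈ S, Matrix.vecMulVec (P.a i) (P.a i) =
      (Matrix.of fun k => P.a (f k)).transpose * Matrix.of fun k => P.a (f k) := by
    rw [hS', Finset.sum_image hf.injOn]
    ext p q
    simp [Matrix.sum_apply, Matrix.mul_apply, Matrix.vecMulVec_apply]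
  rw [normalVolume, h, Matrix.det_mul, Matrix.det_transpose, Real.sqrt_mul_self_eq_abs]

theorem IsSimpleArrangement.normalVolume_ne_zero (hP : P.IsSimpleArrangement) (hn : 0 < n)
    {u : Fin n → ℝ} (hu : u ∈ P.vertices) : P.normalVolume (P.tight u) ≠ 0 := by
  have hcard := hP.card_tight hu
  let f : Fin n → Fin d := fun k => ((P.tight u).equivFinOfCardEq hcard).symm k
  have hrange : Set.range f = P.tight u := by
    rw [show f = Subtype.val ∘ ((P.tight u).equivFinOfCardEq hcard).symm from rfl, Set.range_comp,
      Equiv.range_eq_univ, Set.image_univ, Subtype.range_coe]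
  rw [P.normalVolume_eq_abs_det (Subtype.val_injective.comp (Equiv.injective _)) hrange, Ne, abs_eq_zero,
    ← Matrix.exists_mulVec_eq_zero_iff]
  rintro ⟨e, he, h⟩
  refine he (hP.eq_zero_of_dotProduct hn hcard (fun i hi => P.mem_tight.1 hi) fun i hi => ?_)
  obtain ⟨k, rfl⟩ : i ∈ Set.range f := hrange ▸ hi
  exact congrFun h k

/-- As functions of the row `b`, the determinant of the matrix with rows `b` and `a r`, `r ∈ T`,
and the product `b ⬝ᵥ e` are proportional linear forms, since both vanish on the rows `a r`. -/
theorem normalVolume_insert_mul {T : Finset (Fin d)} (hT : T.card + 1 = n) {i j : Fin d}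
    (hi : i ∉ T) (hj : j ∉ T) {e : Fin n → ℝ} (he : e ≠ 0) (heT : ∀ r ∈ T, P.a r ⬝ᵥ e = 0) :
    P.normalVolume (insert j T) * |P.a i ⬝ᵥ e| = P.normalVolume (insert i T) * |P.a j ⬝ᵥ e| := by
  subst hT
  let f : Fin T.card → Fin d := fun k => T.equivFin.symm k
  have hrange : Set.range f = T := by
    rw [show f = Subtype.val ∘ T.equivFin.symm from rfl, Set.range_comp, Equiv.range_eq_univ,
      Set.image_univ, Subtype.range_coe]
  let M : Matrix (Fin (T.card + 1)) (Fin (T.card + 1)) ℝ := Matrix.of (Fin.cons 0 fun k => P.a (f k))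
  have hvol : ∀ r ∉ T, P.normalVolume (insert r T) = |(M.updateRow 0 (P.a r)).det| := by
    intro r hr
    rw [P.normalVolume_eq_abs_det (f := Fin.cons r f)]
    · congr 2
      ext k l
      refine Fin.cases ?_ (fun k => ?_) k
      · simp
      · simp [M]
    · rw [Fin.cons_injective_iff]
      exact ⟨by rwa [hrange], Subtype.val_injective.comp (Equiv.injective _)⟩
    · rw [Fin.range_cons, hrange, Finset.coe_insert]
  have hdet : (M.updateRow 0 ((P.a i ⬝ᵥ e) • P.a j + (-(P.a j ⬝ᵥ e)) • P.a i)).det = 0 := by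
    refine Matrix.exists_mulVec_eq_zero_iff.1 ⟨e, he, funext fun k => ?_⟩
    refine Fin.cases ?_ (fun k => ?_) k
    · simp only [Matrix.mulVec, Matrix.updateRow_self, add_dotProduct, smul_dotProduct, smul_eq_mul,
        Pi.zero_apply]
      ring
    · rw [Matrix.mulVec, Matrix.updateRow_ne (Fin.succ_ne_zero k)]
      exact heT _ (by rw [← Finset.mem_coe, ← hrange]; exact ⟨k, rfl⟩)
  rw [Matrix.det_updateRow_add, Matrix.det_updateRow_smul, Matrix.det_updateRow_smul] at hdet
  rw [hvol i hi, hvol j hj, ← abs_mul, ← abs_mul]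
  congr 1
  linear_combination hdet

/-- The balance condition along the edge from `u` to `v`. -/
theorem IsSimpleArrangement.normalVolume_tight_mul (hP : P.IsSimpleArrangement)
    {u v : Fin n → ℝ} (hu : u ∈ P.vertices) {i j : Fin d} (hj : j ∈ P.tight u)
    (hv : v ∈ P.vertices) (hvT : (P.tight u).erase j ⊆ P.tight v) (hvj : 0 < P.slack j v)
    (hi : i ∈ P.tight v) (hiu : i ∉ P.tight u) :
    P.normalVolume (P.tight u) * P.slack i u = P.normalVolume (P.tight v) * P.slack j v := by
  have hcard : ((P.tight u).erase j).card + 1 = n := by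
    rw [Finset.card_erase_add_one hj, hP.card_tight hu]
  have hiT : i ∉ (P.tight u).erase j := fun h => hiu (Finset.mem_of_mem_erase h)
  have hv' : insert i ((P.tight u).erase j) = P.tight v :=
    Finset.eq_of_subset_of_card_le (Finset.insert_subset hi hvT)
      (by rw [Finset.card_insert_of_notMem hiT, hcard, hP.card_tight hv])
  have hne : v - u ≠ 0 := fun h => by
    rw [sub_eq_zero.1 h, P.mem_tight.1 hj] at hvj
    exact hvj.false
  have h := normalVolume_insert_mul hcard hiT (Finset.notMem_erase j _) hne fun r hr => by
    rw [dotProduct_sub_eq, P.mem_tight.1 (hvT hr), P.mem_tight.1 (Finset.mem_of_mem_erase hr),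
      sub_zero]
  rw [Finset.insert_erase hj, hv', dotProduct_sub_eq, dotProduct_sub_eq, P.mem_tight.1 hi,
    P.mem_tight.1 hj, sub_zero, zero_sub, abs_neg, abs_of_pos hvj,
    abs_of_nonneg (slack_nonneg (vertices_subset_body hu) i)] at h
  exact h

/-! ### The residual arrangement and the Wachspress coordinates -/

/-- The point with homogeneous coordinates `x` lies in the residual arrangement. -/
def IsResidual (P : Polytope n d) (x : Fin (n + 1) → ℂ) : Prop :=
  ∀ u ∈ P.vertices, ∃ i ∉ P.tight u, P.facetDual i x = 0

/-- A point is residual if and only if no vertex lies on all facet hyperplanes through the point,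
because every non-empty face contains a vertex. -/
theorem mk_mem_residualArrangement {x : Fin (n + 1) → ℂ} (hx : x ≠ 0) :
    Projectivization.mk ℂ x hx ∈ P.residualArrangement ↔ P.IsResidual x := by
  have hyp : ∀ {y : Fin (n + 1) → ℂ} (hy : y ≠ 0) i,
      Projectivization.mk ℂ y hy ∈ P.hyperplane i ↔ P.facetDual i y = 0 := fun hy i => by
    rw [← eval_facetForm]
    exact vanishesAt_mk (P.facetForm_isHomogeneous i) hy
  have hyp' : ∀ y i, toProj y ∈ P.hyperplane i ↔ i ∈ P.tight y := fun y i => by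
    rw [mem_tight, ← Complex.ofReal_eq_zero, ← facetDual_homogenize]
    exact hyp _ i
  constructor
  · rintro ⟨S, hxS, hS⟩ u hu
    have h := hS {u} ⟨Set.singleton_nonempty u, convex_singleton u, isExtreme_singleton.2 hu⟩
    contrapose! h
    intro q hq
    refine Set.mem_iInter₂.2 fun i hi => hq 1 _ (P.facetForm_isHomogeneous i) ?_
    rintro _ ⟨y, rfl, rfl⟩
    by_contra hiu
    exact h i (fun h' => hiu ((hyp' _ i).2 h')) ((hyp hx i).1 (Set.mem_iInter₂.1 hxS i hi))
  · intro h
    refine ⟨{i | P.facetDual i x = 0}, Set.mem_iInter₂.2 fun i hi => (hyp hx i).2 hi, ?_⟩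
    rintro F ⟨⟨y, hy⟩, -, hF⟩ hsub
    obtain ⟨u, hu, hyu⟩ := exists_vertex_tight_subset (hF.subset hy)
    obtain ⟨i, hiu, hi⟩ := h u hu
    have hmem : toProj y ∈ zariskiClosure (toProj '' F) := fun m f _ hf => hf _ ⟨y, hy, rfl⟩
    exact hiu (hyu ((hyp' y i).1 (Set.mem_iInter₂.1 (hsub hmem) i hi)))

theorem mem_residualForms {m : ℕ} {f : MvPolynomial (Fin (n + 1)) ℂ} :
    f ∈ P.residualForms m ↔ f.IsHomogeneous m ∧
      ∀ x, x ≠ 0 → P.IsResidual x → MvPolynomial.eval x f = 0 := by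
  refine and_congr_right fun hf => ⟨fun h x hx hr => ?_, fun h p hp => ?_⟩
  · exact (vanishesAt_mk hf hx).1 (h _ ((mk_mem_residualArrangement hx).2 hr))
  · refine h _ p.rep_nonzero ((mk_mem_residualArrangement p.rep_nonzero).1 ?_)
    rwa [p.mk_rep]

theorem notMem_facet_iff (u : P.vertices) (i : Fin d) :
    (u : Fin n → ℝ) ∉ P.facet i ↔ i ∈ (P.tight u)ᶜ := by
  rw [Finset.mem_compl, mem_tight, not_iff_not]
  exact and_iff_right (vertices_subset_body u.2)

theorem wachspressForm_eq (u : P.vertices) :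
    P.wachspressForm u = ∏ i ∈ (P.tight u)ᶜ, P.facetForm i :=
  Finset.prod_congr (by ext i; simp only [Finset.mem_filter_univ, notMem_facet_iff]) fun _ _ => rfl

theorem eval_wachspressForm (u : P.vertices) (x : Fin (n + 1) → ℂ) :
    MvPolynomial.eval x (P.wachspressForm u) = ∏ i ∈ (P.tight u)ᶜ, P.facetDual i x := by
  simp only [wachspressForm_eq, map_prod, eval_facetForm]

theorem IsSimpleArrangement.wachspressForm_isHomogeneous (hP : P.IsSimpleArrangement)
    (u : P.vertices) : (P.wachspressForm u).IsHomogeneous (d - n) := by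
  have h := MvPolynomial.IsHomogeneous.prod (P.tight u)ᶜ P.facetForm _
    fun i _ => P.facetForm_isHomogeneous i
  rw [Finset.sum_const, Finset.card_compl, hP.card_tight u.2, Fintype.card_fin, smul_eq_mul,
    mul_one] at h
  rwa [wachspressForm_eq]

theorem eval_wachspressForm_eq_zero {u : P.vertices} {x : Fin (n + 1) → ℂ} {i : Fin d}
    (hi : i ∉ P.tight u) (hx : P.facetDual i x = 0) :
    MvPolynomial.eval x (P.wachspressForm u) = 0 := by
  rw [eval_wachspressForm]
  exact Finset.prod_eq_zero (Finset.mem_compl.2 hi) hx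

theorem eval_wachspressForm_homogenize_self_ne_zero (u : P.vertices) :
    MvPolynomial.eval (homogenize (u : Fin n → ℝ)) (P.wachspressForm u) ≠ 0 := by
  rw [eval_wachspressForm, Finset.prod_ne_zero_iff]
  intro i hi
  rw [facetDual_homogenize, Complex.ofReal_ne_zero]
  exact fun h => Finset.mem_compl.1 hi (P.mem_tight.2 h)

theorem IsSimpleArrangement.eval_wachspressForm_homogenize_of_ne (hP : P.IsSimpleArrangement)
    (hn : 0 < n) {u v : P.vertices} (h : v ≠ u) :
    MvPolynomial.eval (homogenize (u : Fin n → ℝ)) (P.wachspressForm v) = 0 := by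
  obtain ⟨i, hiu, hiv⟩ := Finset.not_subset.1 fun hs : P.tight u ⊆ P.tight v =>
    h (Subtype.ext (hP.eq_of_tight_subset hn u.2 hs))
  exact eval_wachspressForm_eq_zero hiv
    (by rw [facetDual_homogenize, P.mem_tight.1 hiu, Complex.ofReal_zero])

theorem IsSimpleArrangement.wachspressForm_mem (hP : P.IsSimpleArrangement) (u : P.vertices) :
    P.wachspressForm u ∈ P.residualForms (d - n) := by
  refine mem_residualForms.2 ⟨hP.wachspressForm_isHomogeneous u, fun x _ hr => ?_⟩
  obtain ⟨i, hi, hx⟩ := hr u u.2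
  exact eval_wachspressForm_eq_zero hi hx

theorem IsSimpleArrangement.linearIndependent_wachspressForm (hP : P.IsSimpleArrangement)
    (hn : 0 < n) : LinearIndependent ℂ P.wachspressForm := by
  rw [linearIndependent_iff']
  intro s g hg u hu
  have h := congrArg (MvPolynomial.eval (homogenize (u : Fin n → ℝ))) hg
  rw [map_sum, map_zero, Finset.sum_eq_single_of_mem u hu, MvPolynomial.smul_eval] at h
  · exact (mul_eq_zero.1 h).resolve_right (eval_wachspressForm_homogenize_self_ne_zero u)
  · intro v _ hvu
    rw [MvPolynomial.smul_eval, hP.eval_wachspressForm_homogenize_of_ne hn hvu, mul_zero]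

theorem IsSimpleArrangement.exists_eq_smul_homogenize (hP : P.IsSimpleArrangement) (hn : 0 < n)
    {u : Fin n → ℝ} (hu : u ∈ P.vertices) {x : Fin (n + 1) → ℂ}
    (hx : x ∈ flat P.facetDual (P.tight u)) : ∃ c : ℂ, x = c • homogenize u := by
  classical
  obtain ⟨j, hj⟩ : ∃ j, j ∉ P.tight u := by
    by_contra! h
    have h1 := P.lt_card_facets hn
    have h2 := hP.card_tight hu
    rw [Finset.eq_univ_iff_forall.2 h, Finset.card_univ, Fintype.card_fin] at h2
    omega
  have hju : P.facetDual j (homogenize u) ≠ 0 := by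
    rw [facetDual_homogenize, Complex.ofReal_ne_zero]
    exact fun h => hj (P.mem_tight.2 h)
  refine ⟨P.facetDual j x / P.facetDual j (homogenize u), sub_eq_zero.1 ?_⟩
  refine hP.inGeneralPosition (insert j (P.tight u))
    (by rw [Finset.card_insert_of_notMem hj, hP.card_tight hu]; omega) _ fun i hi => ?_
  rcases Finset.mem_insert.1 hi with rfl | hi
  · simp [hju]
  · simp [hx i hi, facetDual_homogenize, P.mem_tight.1 hi]

/-- A form of degree `d - n` that vanishes on the residual arrangement is determined by its values at
the vertices: a form of degree `d - n` that vanishes in all points in which `n` of the hyperplanes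
meet is zero, and each of these points is a vertex or a residual point. -/
theorem IsSimpleArrangement.eq_sum_wachspressForm [Fintype P.vertices] (hP : P.IsSimpleArrangement) (hn : 0 < n)
    {f : MvPolynomial (Fin (n + 1)) ℂ} (hf : f ∈ P.residualForms (d - n)) :
    f = ∑ u : P.vertices, (MvPolynomial.eval (homogenize (u : Fin n → ℝ)) f /
      MvPolynomial.eval (homogenize (u : Fin n → ℝ)) (P.wachspressForm u)) • P.wachspressForm u := by
  have hnd := P.lt_card_facets hn
  set s := ∑ u : P.vertices, (MvPolynomial.eval (homogenize (u : Fin n → ℝ)) f /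
      MvPolynomial.eval (homogenize (u : Fin n → ℝ)) (P.wachspressForm u)) • P.wachspressForm u
    with hs
  have hmem : f - s ∈ P.residualForms (d - n) :=
    Submodule.sub_mem _ hf (Submodule.sum_mem _ fun u _ =>
      Submodule.smul_mem _ _ (hP.wachspressForm_mem u))
  have hhom := (mem_residualForms.1 hmem).1
  rw [← sub_eq_zero]
  refine hP.inGeneralPosition.eq_zero_of_forall_mem_flat (k := n) (by simp) (by simpa using hnd)
    le_rfl ?_ fun T hT x hx => ?_
  · have := hhom.totalDegree_le
    rw [Fintype.card_fin]
    omega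
  by_cases hx0 : x = 0
  · have := eval_smul_of_isHomogeneous hhom 0 x
    rwa [zero_smul, zero_pow (by omega), zero_mul, ← hx0] at this
  by_cases hr : P.IsResidual x
  · exact (mem_residualForms.1 hmem).2 x hx0 hr
  · simp only [IsResidual, not_forall, not_exists, not_and] at hr
    obtain ⟨u, hu, hur⟩ := hr
    have hTu : T = P.tight u := Finset.eq_of_subset_of_card_le
      (fun i hi => by_contra fun h => hur i h (hx i hi)) (by rw [hT, hP.card_tight hu])
    obtain ⟨c, rfl⟩ := hP.exists_eq_smul_homogenize hn hu (hTu ▸ hx)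
    rw [eval_smul_of_isHomogeneous hhom, map_sub, hs, map_sum,
      Finset.sum_eq_single_of_mem (⟨u, hu⟩ : P.vertices) (Finset.mem_univ _),
      MvPolynomial.smul_eval,
      div_mul_cancel₀ _ (eval_wachspressForm_homogenize_self_ne_zero (⟨u, hu⟩ : P.vertices)),
      sub_self, mul_zero]
    intro v _ hv
    rw [MvPolynomial.smul_eval, hP.eval_wachspressForm_homogenize_of_ne hn hv, mul_zero]

theorem IsSimpleArrangement.span_wachspressForm (hP : P.IsSimpleArrangement) (hn : 0 < n) :
    Submodule.span ℂ (Set.range P.wachspressForm) = P.residualForms (d - n) := by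
  have := (hP.finite_vertices hn).fintype
  refine le_antisymm (Submodule.span_le.2 ?_) fun f hf => ?_
  · rintro _ ⟨u, rfl⟩
    exact hP.wachspressForm_mem u
  · rw [hP.eq_sum_wachspressForm hn hf]
    exact Submodule.sum_mem _ fun u _ => Submodule.smul_mem _ _ (Submodule.subset_span ⟨u, rfl⟩)

/-! ### Restriction to the edges -/

/-- The vertices `u` and `v` are joined by an edge; the facets through `u` and those through `v` are
the same except for `j ∋ u` and `i ∋ v`. -/
structure IsEdge (P : Polytope n d) (j i : Fin d) (u v : P.vertices) : Prop where
  left_mem : j ∈ P.tight u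
  right_mem : i ∈ P.tight v
  left_notMem : i ∉ P.tight u
  right_notMem : j ∉ P.tight v
  erase_subset : (P.tight u).erase j ⊆ P.tight v

theorem IsSimpleArrangement.exists_isEdge (hP : P.IsSimpleArrangement) {u v : P.vertices}
    {j : Fin d} (hj : j ∈ P.tight u) (hvT : (P.tight u).erase j ⊆ P.tight v)
    (hvj : 0 < P.slack j v) : ∃ i, P.IsEdge j i u v := by
  have hjv : j ∉ P.tight v := fun h => hvj.ne' (P.mem_tight.1 h)
  obtain ⟨i, hiv, hiu⟩ := Finset.not_subset.1 fun hs : P.tight v ⊆ P.tight u =>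
    hjv ((Finset.eq_of_subset_of_card_le hs
      (by rw [hP.card_tight u.2, hP.card_tight v.2])).symm ▸ hj)
  exact ⟨i, hj, hiv, hiu, hjv, hvT⟩

namespace IsEdge

variable {j i : Fin d} {u v : P.vertices}

theorem ne (h : P.IsEdge j i u v) : v ≠ u := fun e => h.right_notMem (e ▸ h.left_mem)

theorem slack_left_pos (h : P.IsEdge j i u v) : 0 < P.slack i u :=
  slack_pos (vertices_subset_body u.2) h.left_notMem

theorem slack_right_pos (h : P.IsEdge j i u v) : 0 < P.slack j v :=
  slack_pos (vertices_subset_body v.2) h.right_notMem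

theorem tight_right (h : P.IsEdge j i u v) (hP : P.IsSimpleArrangement) :
    P.tight v = insert i ((P.tight u).erase j) :=
  (Finset.eq_of_subset_of_card_le (Finset.insert_subset h.right_mem h.erase_subset) (by
    rw [Finset.card_insert_of_notMem fun hi => h.left_notMem (Finset.mem_of_mem_erase hi),
      Finset.card_erase_add_one h.left_mem, hP.card_tight u.2, hP.card_tight v.2])).symm

/-- Points on the line of an edge as combinations of its vertices. -/
theorem eq_add (h : P.IsEdge j i u v) (hP : P.IsSimpleArrangement) {x : Fin (n + 1) → ℂ}
    (hx : x ∈ flat P.facetDual ((P.tight u).erase j)) :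
    x = (P.facetDual i x / P.slack i u) • homogenize u +
      (P.facetDual j x / P.slack j v) • homogenize v := by
  rw [← sub_eq_zero]
  refine hP.inGeneralPosition (insert i (P.tight u))
    (by rw [Finset.card_insert_of_notMem h.left_notMem, hP.card_tight u.2]; omega) _ fun r hr => ?_
  have hi := Complex.ofReal_ne_zero.2 h.slack_left_pos.ne'
  have hj := Complex.ofReal_ne_zero.2 h.slack_right_pos.ne'
  simp only [map_sub, map_add, map_smul, facetDual_homogenize, smul_eq_mul]
  rcases Finset.mem_insert.1 hr with rfl | hr
  · simp [P.mem_tight.1 h.right_mem, hi]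
  · by_cases hrj : r = j
    · subst hrj
      simp [P.mem_tight.1 hr, hj]
    · have hr' := Finset.mem_erase.2 ⟨hrj, hr⟩
      simp [P.mem_tight.1 hr, P.mem_tight.1 (h.erase_subset hr'), hx r hr']

theorem eval_left (h : P.IsEdge j i u v) (x : Fin (n + 1) → ℂ) :
    MvPolynomial.eval x (P.wachspressForm u) =
      P.facetDual i x * ∏ r ∈ (insert i (P.tight u))ᶜ, P.facetDual r x := by
  rw [eval_wachspressForm, Finset.compl_insert,
    Finset.mul_prod_erase _ (fun r => P.facetDual r x) (Finset.mem_compl.2 h.left_notMem)]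

theorem eval_right (h : P.IsEdge j i u v) (hP : P.IsSimpleArrangement) (x : Fin (n + 1) → ℂ) :
    MvPolynomial.eval x (P.wachspressForm v) =
      P.facetDual j x * ∏ r ∈ (insert i (P.tight u))ᶜ, P.facetDual r x := by
  have : insert i (P.tight u) = insert j (P.tight v) := by
    rw [h.tight_right hP, Finset.insert_comm, Finset.insert_erase h.left_mem]
  rw [eval_wachspressForm, this, Finset.compl_insert,
    Finset.mul_prod_erase _ (fun r => P.facetDual r x) (Finset.mem_compl.2 h.right_notMem)]

theorem eval_of_ne (h : P.IsEdge j i u v) (hP : P.IsSimpleArrangement) (hn : 0 < n)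
    {x : Fin (n + 1) → ℂ} (hx : x ∈ flat P.facetDual ((P.tight u).erase j)) {w : P.vertices}
    (hwu : w ≠ u) (hwv : w ≠ v) : MvPolynomial.eval x (P.wachspressForm w) = 0 := by
  obtain ⟨r, hr, hrw⟩ := Finset.not_subset.1 fun hs : (P.tight u).erase j ⊆ P.tight w =>
    hwv <| Subtype.ext <| hP.eq_of_erase_subset hn u.2 h.left_mem v.2 h.erase_subset
      h.slack_right_pos w.2 hs fun e => hwu (Subtype.ext e)
  exact eval_wachspressForm_eq_zero hrw (hx r hr)

/-- On the line of an edge, only the Wachspress coordinates of its two vertices do not vanish. -/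
theorem sum_eval [Fintype P.vertices] (h : P.IsEdge j i u v) (hP : P.IsSimpleArrangement) (hn : 0 < n)
    {x : Fin (n + 1) → ℂ} (hx : x ∈ flat P.facetDual ((P.tight u).erase j)) (c : P.vertices → ℂ) :
    ∑ w, c w * MvPolynomial.eval x (P.wachspressForm w) =
      (c u * P.facetDual i x + c v * P.facetDual j x) *
        ∏ r ∈ (insert i (P.tight u))ᶜ, P.facetDual r x := by
  classical
  rw [Fintype.sum_eq_add u v h.ne.symm, h.eval_left, h.eval_right hP]
  · ring
  · rintro w ⟨hwu, hwv⟩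
    rw [h.eval_of_ne hP hn hx hwu hwv, mul_zero]

end IsEdge

/-! ### Existence of the adjoint -/

/-- The combination of the Wachspress coordinates with the homogeneous coordinates of the vertices as
coefficients, weighted by the volumes spanned by the facet normals. For index `0` this is the numerator
in Warren's formula for the adjoint. -/
noncomputable def weightedSum (P : Polytope n d) [Fintype P.vertices] (k : Fin (n + 1)) :
    MvPolynomial (Fin (n + 1)) ℂ :=
  ∑ u : P.vertices, ((P.normalVolume (P.tight u) : ℂ) * homogenize (u : Fin n → ℝ) k) •
    P.wachspressForm u

theorem IsSimpleArrangement.weightedSum_mem [Fintype P.vertices] (hP : P.IsSimpleArrangement) (k : Fin (n + 1)) :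
    P.weightedSum k ∈ P.residualForms (d - n) :=
  Submodule.sum_mem _ fun u _ => Submodule.smul_mem _ _ (hP.wachspressForm_mem u)

theorem eval_weightedSum [Fintype P.vertices] (k : Fin (n + 1)) (x : Fin (n + 1) → ℂ) :
    MvPolynomial.eval x (P.weightedSum k) = ∑ u : P.vertices,
      ((P.normalVolume (P.tight u) : ℂ) * homogenize (u : Fin n → ℝ) k) *
        MvPolynomial.eval x (P.wachspressForm u) := by
  simp only [weightedSum, map_sum, MvPolynomial.smul_eval]

/-- Both sides have degree `d - n + 1`, so it suffices to compare them on the lines in which `n - 1`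
hyperplanes meet. The Wachspress coordinates vanish on these lines, except for those of the two vertices
of an edge on its line. There, the balance condition for the weights gives the equality. -/
theorem IsSimpleArrangement.X_mul_weightedSum [Fintype P.vertices] (hP : P.IsSimpleArrangement) (hn : 0 < n)
    (k l : Fin (n + 1)) : MvPolynomial.X k * P.weightedSum l = MvPolynomial.X l * P.weightedSum k := by
  have hnd := P.lt_card_facets hn
  have hhom : (MvPolynomial.X k * P.weightedSum l -
      MvPolynomial.X l * P.weightedSum k).IsHomogeneous (1 + (d - n)) :=
    ((MvPolynomial.isHomogeneous_X ℂ k).mul (mem_residualForms.1 (hP.weightedSum_mem l)).1).sub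
      ((MvPolynomial.isHomogeneous_X ℂ l).mul (mem_residualForms.1 (hP.weightedSum_mem k)).1)
  rw [← sub_eq_zero]
  refine hP.inGeneralPosition.eq_zero_of_forall_mem_flat (k := n - 1) (by simp) (by simpa using hnd)
    (by omega) ?_ fun T hT x hx => ?_
  · have := hhom.totalDegree_le
    rw [Fintype.card_fin]
    omega
  simp only [map_sub, map_mul, MvPolynomial.eval_X, eval_weightedSum]
  by_cases hTu : ∃ u ∈ P.vertices, T ⊆ P.tight u
  · obtain ⟨u, hu, hTu⟩ := hTu
    obtain ⟨j, hju, hjT⟩ := Finset.exists_mem_notMem_of_card_lt_card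
      (show T.card < (P.tight u).card by rw [hT, hP.card_tight hu]; omega)
    have hT' : T = (P.tight u).erase j := Finset.eq_of_subset_of_card_le
      (Finset.subset_erase.2 ⟨hTu, hjT⟩)
      (by rw [Finset.card_erase_of_mem hju, hT, hP.card_tight hu])
    obtain ⟨v, hv, hvT, hvj⟩ := hP.exists_adjacent hn hu hju
    obtain ⟨i, he⟩ := hP.exists_isEdge (u := ⟨u, hu⟩) (v := ⟨v, hv⟩) hju hvT hvj
    have hbal : (P.normalVolume (P.tight u) : ℂ) * P.slack i u =
        P.normalVolume (P.tight v) * P.slack j v := by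
      exact_mod_cast hP.normalVolume_tight_mul hu hju hv hvT hvj he.right_mem he.left_notMem
    rw [hT'] at hx
    have hi := Complex.ofReal_ne_zero.2 he.slack_left_pos.ne'
    have hj := Complex.ofReal_ne_zero.2 he.slack_right_pos.ne'
    have hk := congrFun (he.eq_add hP hx) k
    have hl := congrFun (he.eq_add hP hx) l
    simp only [Pi.add_apply, Pi.smul_apply, smul_eq_mul] at hk hl
    rw [he.sum_eval hP hn hx, he.sum_eval hP hn hx, hk, hl]
    dsimp only at hi hj ⊢
    field_simp
    generalize (∏ r ∈ (insert i (P.tight u))ᶜ, P.facetDual r x) = ψ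
    linear_combination (ψ * P.facetDual i x * P.facetDual j x *
      (homogenize u l * homogenize v k - homogenize u k * homogenize v l)) * hbal
  · push Not at hTu
    have : ∀ u : P.vertices, MvPolynomial.eval x (P.wachspressForm u) = 0 := fun u => by
      obtain ⟨i, hiT, hiu⟩ := Finset.not_subset.1 (hTu u u.2)
      exact eval_wachspressForm_eq_zero hiu (hx i hiT)
    simp [this]

/-- The adjoint `α`: the quotient of `P.weightedSum 0` by the coordinate `X 0`. It vanishes in the
residual points, since the products `X k * α` do and the `X k` have no common zero. -/
theorem IsSimpleArrangement.exists_adjoint [Fintype P.vertices] (hP : P.IsSimpleArrangement) (hn : 0 < n) :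
    ∃ α ∈ P.residualForms (d - n - 1), ∀ k, MvPolynomial.X k * α = P.weightedSum k := by
  have hnd := P.lt_card_facets hn
  obtain ⟨α, hα⟩ : MvPolynomial.X 0 ∣ P.weightedSum 0 := by
    have h : (MvPolynomial.X 0 : MvPolynomial (Fin (n + 1)) ℂ) ∣
        MvPolynomial.X (Fin.last n) * P.weightedSum 0 :=
      ⟨_, hP.X_mul_weightedSum hn (Fin.last n) 0⟩
    refine (MvPolynomial.X_dvd_mul_iff.1 h).resolve_left fun h' => ?_
    have := congrArg Fin.val (MvPolynomial.X_dvd_X.1 h')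
    simp at this
    omega
  have hX : ∀ k, MvPolynomial.X k * α = P.weightedSum k := fun k => by
    have h := hP.X_mul_weightedSum hn k 0
    rw [hα, mul_left_comm] at h
    exact MvPolynomial.X_mul_cancel_left_iff.1 h
  refine ⟨α, mem_residualForms.2 ⟨fun m hm => ?_, fun x hx hr => ?_⟩, hX⟩
  · have h := (mem_residualForms.1 (hP.weightedSum_mem 0)).1
    rw [← MvPolynomial.coeff_X_mul m 0 α, ← hα] at hm
    have := h hm
    simp only [map_add, Finsupp.weight_single, Pi.one_apply, smul_eq_mul, mul_one] at this
    omega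
  · obtain ⟨k, hk⟩ := Function.ne_iff.1 hx
    have h := congrArg (MvPolynomial.eval x) (hX k)
    rw [map_mul, MvPolynomial.eval_X,
      (mem_residualForms.1 (hP.weightedSum_mem k)).2 x hx hr] at h
    exact (mul_eq_zero.1 h).resolve_left hk

theorem IsSimpleArrangement.eval_homogenize_ne_zero [Fintype P.vertices]
    (hP : P.IsSimpleArrangement) (hn : 0 < n) {α : MvPolynomial (Fin (n + 1)) ℂ}
    (hα : ∀ k, MvPolynomial.X k * α = P.weightedSum k) (u : P.vertices) :
    MvPolynomial.eval (homogenize (u : Fin n → ℝ)) α =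
      P.normalVolume (P.tight u) *
        MvPolynomial.eval (homogenize (u : Fin n → ℝ)) (P.wachspressForm u) ∧
    MvPolynomial.eval (homogenize (u : Fin n → ℝ)) α ≠ 0 := by
  have h := congrArg (MvPolynomial.eval (homogenize (u : Fin n → ℝ))) (hα 0)
  rw [map_mul, MvPolynomial.eval_X, homogenize_zero, one_mul, eval_weightedSum,
    Finset.sum_eq_single_of_mem u (Finset.mem_univ _), homogenize_zero, mul_one] at h
  · refine ⟨h, h ▸ mul_ne_zero ?_ (eval_wachspressForm_homogenize_self_ne_zero u)⟩
    exact Complex.ofReal_ne_zero.2 (hP.normalVolume_ne_zero hn u.2)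
  · intro v _ hv
    rw [hP.eval_wachspressForm_homogenize_of_ne hn hv, mul_zero]

/-! ### Uniqueness of the adjoint -/

/-- The product of a facet form and a form of degree `d - n - 1` that vanishes on the residual
arrangement, expanded in the Wachspress coordinates. -/
theorem IsSimpleArrangement.facetForm_mul_eq_sum [Fintype P.vertices] (hP : P.IsSimpleArrangement)
    (hn : 0 < n) {β : MvPolynomial (Fin (n + 1)) ℂ} (hβ : β ∈ P.residualForms (d - n - 1))
    (i : Fin d) : P.facetForm i * β = ∑ u : P.vertices,
      (P.slack i u * MvPolynomial.eval (homogenize (u : Fin n → ℝ)) β /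
        MvPolynomial.eval (homogenize (u : Fin n → ℝ)) (P.wachspressForm u)) •
          P.wachspressForm u := by
  have hnd := P.lt_card_facets hn
  have hmem : P.facetForm i * β ∈ P.residualForms (d - n) := by
    obtain ⟨h1, h2⟩ := mem_residualForms.1 hβ
    refine mem_residualForms.2 ⟨?_, fun x hx hr => by rw [map_mul, h2 x hx hr, mul_zero]⟩
    have := (P.facetForm_isHomogeneous i).mul h1
    rwa [show 1 + (d - n - 1) = d - n by omega] at this
  refine (hP.eq_sum_wachspressForm hn hmem).trans (Finset.sum_congr rfl fun u _ => ?_)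
  rw [map_mul, eval_facetForm, facetDual_homogenize]

/-- The expansion `facetForm_mul_eq_sum` on the line of an edge, where only the two terms of its
vertices remain. -/
theorem IsEdge.facetDual_mul_eval [Fintype P.vertices] {j i : Fin d} {u v : P.vertices}
    (h : P.IsEdge j i u v) (hP : P.IsSimpleArrangement) (hn : 0 < n)
    {β : MvPolynomial (Fin (n + 1)) ℂ} (hβ : β ∈ P.residualForms (d - n - 1))
    {x : Fin (n + 1) → ℂ} (hx : x ∈ flat P.facetDual ((P.tight u).erase j)) (r : Fin d) :
    P.facetDual r x * MvPolynomial.eval x β =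
      (P.slack r u * MvPolynomial.eval (homogenize (u : Fin n → ℝ)) β /
          MvPolynomial.eval (homogenize (u : Fin n → ℝ)) (P.wachspressForm u) * P.facetDual i x +
        P.slack r v * MvPolynomial.eval (homogenize (v : Fin n → ℝ)) β /
          MvPolynomial.eval (homogenize (v : Fin n → ℝ)) (P.wachspressForm v) * P.facetDual j x) *
        ∏ r ∈ (insert i (P.tight u))ᶜ, P.facetDual r x := by
  have h1 := congrArg (MvPolynomial.eval x) (hP.facetForm_mul_eq_sum hn hβ r)
  simp only [map_mul, eval_facetForm, map_sum, MvPolynomial.smul_eval] at h1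
  rw [h1, h.sum_eval hP hn hx]

theorem IsEdge.eval_right_eq_zero {j i : Fin d} {u v : P.vertices}
    (h : P.IsEdge j i u v) (hP : P.IsSimpleArrangement) (hn : 0 < n)
    {β : MvPolynomial (Fin (n + 1)) ℂ} (hβ : β ∈ P.residualForms (d - n - 1))
    (hu : MvPolynomial.eval (homogenize (u : Fin n → ℝ)) β = 0) :
    MvPolynomial.eval (homogenize (v : Fin n → ℝ)) β = 0 := by
  have := (hP.finite_vertices hn).fintype
  have hnd := P.lt_card_facets hn
  obtain ⟨q, hq, hq0⟩ := hP.inGeneralPosition.exists_mem_flat_forall_ne_zero (by simp)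
    (by simpa using hnd) (T := (P.tight u).erase j)
    (by rw [Finset.card_erase_of_mem h.left_mem, hP.card_tight u.2]; omega)
  have hi := hq0 i fun h' => h.left_notMem (Finset.mem_of_mem_erase h')
  have hj := hq0 j (Finset.notMem_erase _ _)
  have hψ : ∏ r ∈ (insert i (P.tight u))ᶜ, P.facetDual r q ≠ 0 :=
    Finset.prod_ne_zero_iff.2 fun r hr => hq0 r fun h' => Finset.mem_compl.1 hr
      (Finset.mem_insert_of_mem (Finset.mem_of_mem_erase h'))
  have h1 := h.facetDual_mul_eval hP hn hβ hq i
  have h2 := h.facetDual_mul_eval hP hn hβ hq j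
  simp only [hu, P.mem_tight.1 h.right_mem, Complex.ofReal_zero, mul_zero, zero_mul, zero_div,
    add_zero, mul_eq_zero, hi, false_or] at h1
  simp only [hu, h1, mul_zero, zero_mul, zero_div, zero_add, zero_eq_mul, hψ, hj, or_false,
    div_eq_zero_iff, eval_wachspressForm_homogenize_self_ne_zero, mul_eq_zero,
    Complex.ofReal_eq_zero, h.slack_right_pos.ne', false_or] at h2
  exact h2

/-- Vanishing in a vertex propagates along the edges, and the graph of the polytope is connected. -/
theorem IsSimpleArrangement.eq_zero_of_eval_vertex_eq_zero (hP : P.IsSimpleArrangement) (hn : 0 < n)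
    {β : MvPolynomial (Fin (n + 1)) ℂ} (hβ : β ∈ P.residualForms (d - n - 1)) {u : Fin n → ℝ}
    (hu : u ∈ P.vertices) (hβu : MvPolynomial.eval (homogenize u) β = 0) : β = 0 := by
  have := (hP.finite_vertices hn).fintype
  have hall := hP.forall_vertex_of_adjacent hn (p := fun w => MvPolynomial.eval (homogenize w) β = 0)
    ⟨u, hu, hβu⟩ fun u hu hβu j hj v hv hvT hvj => by
      obtain ⟨i, he⟩ := hP.exists_isEdge (u := ⟨u, hu⟩) (v := ⟨v, hv⟩) hj hvT hvj
      exact he.eval_right_eq_zero hP hn hβ hβu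
  obtain ⟨j, hj⟩ := Finset.card_pos.1 (by rw [hP.card_tight hu]; exact hn)
  obtain ⟨v, hv, -, hvj⟩ := hP.exists_adjacent hn hu hj
  have hmul : P.facetForm j * β = 0 := by
    rw [hP.facetForm_mul_eq_sum hn hβ]
    exact Finset.sum_eq_zero fun w _ => by rw [hall w w.2, mul_zero, zero_div, zero_smul]
  refine (mul_eq_zero.1 hmul).resolve_left fun h0 => hvj.ne' ?_
  have := P.eval_facetForm j (homogenize v)
  rw [h0, map_zero, facetDual_homogenize] at this
  exact_mod_cast this.symm

theorem IsSimpleArrangement.exists_smul_adjoint_eq [Fintype P.vertices] (hP : P.IsSimpleArrangement)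
    (hn : 0 < n) {α β : MvPolynomial (Fin (n + 1)) ℂ} (hα : α ∈ P.residualForms (d - n - 1))
    (hX : ∀ k, MvPolynomial.X k * α = P.weightedSum k) (hβ : β ∈ P.residualForms (d - n - 1)) :
    ∃ c : ℂ, c • α = β := by
  obtain ⟨u, hu⟩ := P.nonempty_vertices
  have hαu := (hP.eval_homogenize_ne_zero hn hX ⟨u, hu⟩).2
  refine ⟨MvPolynomial.eval (homogenize u) β / MvPolynomial.eval (homogenize u) α, sub_eq_zero.1 ?_⟩
  refine hP.eq_zero_of_eval_vertex_eq_zero hn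
    (Submodule.sub_mem _ (Submodule.smul_mem _ _ hα) hβ) hu ?_
  rw [map_sub, MvPolynomial.smul_eval, div_mul_cancel₀ _ hαu, sub_self]

theorem IsSimpleArrangement.ne_zero_of_X_mul_eq [Fintype P.vertices] (hP : P.IsSimpleArrangement)
    (hn : 0 < n) {α : MvPolynomial (Fin (n + 1)) ℂ}
    (hX : ∀ k, MvPolynomial.X k * α = P.weightedSum k) : α ≠ 0 := by
  obtain ⟨u, hu⟩ := P.nonempty_vertices
  rintro rfl
  exact (hP.eval_homogenize_ne_zero hn hX ⟨u, hu⟩).2 (map_zero _)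

/-! ### The adjoint is reduced -/

theorem restrictLine_facetForm (P : Polytope n d) (p q : Fin (n + 1) → ℂ) (r : Fin d) :
    restrictLine p q (P.facetForm r) =
      Polynomial.C (P.facetDual r q) * Polynomial.X + Polynomial.C (P.facetDual r p) := by
  refine Polynomial.funext fun t => ?_
  rw [eval_restrictLine, eval_facetForm, map_add, map_smul]
  simp only [Polynomial.eval_add, Polynomial.eval_mul, Polynomial.eval_C, Polynomial.eval_X,
    smul_eq_mul]
  ring

theorem isCoprime_linear {K : Type*} [Field K] {a b c e : K} (h : b * c ≠ e * a) :
    IsCoprime (Polynomial.C a * Polynomial.X + Polynomial.C b)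
      (Polynomial.C c * Polynomial.X + Polynomial.C e) := by
  have h1 : Polynomial.C (b * c - e * a)⁻¹ *
      (Polynomial.C b * Polynomial.C c - Polynomial.C e * Polynomial.C a) = 1 := by
    rw [← Polynomial.C_mul, ← Polynomial.C_mul, ← Polynomial.C_sub, ← Polynomial.C_mul,
      inv_mul_cancel₀ (sub_ne_zero.2 h), Polynomial.C_1]
  refine ⟨Polynomial.C (b * c - e * a)⁻¹ * Polynomial.C c,
    -(Polynomial.C (b * c - e * a)⁻¹ * Polynomial.C a), ?_⟩
  linear_combination h1

/-- On the line of an edge, the adjoint has `d - n - 1` simple zeros, in the residual points of this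
line. Hence, if `f * f * g` is the adjoint, `f` has a constant restriction to the line, and `g` has at
least the degree `d - n - 1` of the adjoint. So `f` is constant. -/
theorem IsSimpleArrangement.squarefree_adjoint [Fintype P.vertices] (hP : P.IsSimpleArrangement)
    (hn : 0 < n) {α : MvPolynomial (Fin (n + 1)) ℂ} (hα : α ∈ P.residualForms (d - n - 1))
    (hX : ∀ k, MvPolynomial.X k * α = P.weightedSum k) : Squarefree α := by
  have hnd := P.lt_card_facets hn
  have hα0 := hP.ne_zero_of_X_mul_eq hn hX
  obtain ⟨u, hu⟩ := P.nonempty_vertices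
  obtain ⟨j, hj⟩ := Finset.card_pos.1 (by rw [hP.card_tight hu]; exact hn)
  obtain ⟨v, hv, hvT, hvj⟩ := hP.exists_adjacent hn hu hj
  obtain ⟨i, he⟩ := hP.exists_isEdge (u := ⟨u, hu⟩) (v := ⟨v, hv⟩) hj hvT hvj
  have hiT : i ∉ (P.tight u).erase j := fun h' => he.left_notMem (Finset.mem_of_mem_erase h')
  have hcard : ((P.tight u).erase j).card + 1 = n := by
    rw [Finset.card_erase_add_one hj, hP.card_tight hu]
  obtain ⟨p, hp, hp0⟩ := hP.inGeneralPosition.exists_mem_flat_forall_ne_zero (by simp)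
    (by simpa using hnd) (T := (P.tight u).erase j) (by omega)
  obtain ⟨q, hq, hq0, hpq⟩ := hP.inGeneralPosition.exists_direction (by simp)
    (by simpa using hnd) hcard.le hp0
  have hU : ∀ r ∈ (insert i (P.tight u))ᶜ, r ∉ (P.tight u).erase j := fun r hr h' =>
    Finset.mem_compl.1 hr (Finset.mem_insert_of_mem (Finset.mem_of_mem_erase h'))
  -- the restriction of the adjoint to a parametrized line inside the edge
  obtain ⟨κ, hκ, hrestr⟩ : ∃ κ : ℂ, κ ≠ 0 ∧ restrictLine p q α =
      Polynomial.C κ * ∏ r ∈ (insert i (P.tight u))ᶜ, restrictLine p q (P.facetForm r) := by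
    refine ⟨P.slack i u * MvPolynomial.eval (homogenize u) α /
      MvPolynomial.eval (homogenize u) (P.wachspressForm ⟨u, hu⟩), ?_, ?_⟩
    · exact div_ne_zero (mul_ne_zero (Complex.ofReal_ne_zero.2 he.slack_left_pos.ne')
        (hP.eval_homogenize_ne_zero hn hX ⟨u, hu⟩).2)
        (eval_wachspressForm_homogenize_self_ne_zero ⟨u, hu⟩)
    · have hi0 : restrictLine p q (P.facetForm i) ≠ 0 := by
        intro h0
        rw [restrictLine_facetForm] at h0
        have := congrArg (Polynomial.eval 0) h0
        simp [hp0 i hiT] at this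
      refine mul_left_cancel₀ hi0 (Polynomial.funext fun t => ?_)
      have hx : p + t • q ∈ flat P.facetDual ((P.tight u).erase j) :=
        Submodule.add_mem _ hp (Submodule.smul_mem _ _ hq)
      have h := he.facetDual_mul_eval hP hn hα hx i
      rw [P.mem_tight.1 he.right_mem] at h
      simp only [Polynomial.eval_mul, Polynomial.eval_C, Polynomial.eval_prod, eval_restrictLine,
        eval_facetForm, h]
      simp only [Complex.ofReal_zero, zero_mul, zero_div, add_zero]
      ring
  have hirr : ∀ r ∈ (insert i (P.tight u))ᶜ, (restrictLine p q (P.facetForm r)).degree = 1 :=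
    fun r hr => by
      rw [restrictLine_facetForm]
      exact Polynomial.degree_linear (hq0 r (hU r hr))
  have hsq : Squarefree (restrictLine p q α) := by
    rw [hrestr, ((associated_unit_mul_left _ _ (Polynomial.isUnit_C.2 hκ.isUnit)).squarefree_iff)]
    refine Finset.squarefree_prod_of_pairwise_isCoprime (fun r hr s hs hrs => ?_) fun r hr =>
      (Polynomial.irreducible_of_degree_eq_one (hirr r hr)).squarefree
    have hr := hU r (Finset.mem_coe.1 hr)
    have hs := hU s (Finset.mem_coe.1 hs)
    change IsRelPrime (restrictLine p q (P.facetForm r)) (restrictLine p q (P.facetForm s))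
    rw [restrictLine_facetForm, restrictLine_facetForm]
    exact (isCoprime_linear (hpq r hr s hs hrs)).isRelPrime
  have hdeg : (restrictLine p q α).natDegree = d - n - 1 := by
    rw [hrestr, Polynomial.natDegree_C_mul hκ, Polynomial.natDegree_prod _ _ fun r hr h0 => by
        simpa [h0] using hirr r hr,
      Finset.sum_congr (g := fun _ => 1) rfl fun r hr =>
        Polynomial.natDegree_eq_of_degree_eq_some (hirr r hr)]
    rw [Finset.sum_const, smul_eq_mul, mul_one, Finset.card_compl,
      Finset.card_insert_of_notMem he.left_notMem, hP.card_tight hu, Fintype.card_fin]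
    omega
  rintro f ⟨g, rfl⟩
  have hf0 : f ≠ 0 := by
    rintro rfl
    simp at hα0
  have hg0 : g ≠ 0 := by
    rintro rfl
    simp at hα0
  have hunit : IsUnit (restrictLine p q f) := hsq _ ⟨restrictLine p q g, by simp only [map_mul]⟩
  have h1 : (restrictLine p q (f * f * g)).natDegree ≤ g.totalDegree := by
    rw [map_mul, map_mul]
    refine (Polynomial.natDegree_mul_le.trans (add_le_add_left Polynomial.natDegree_mul_le _)).trans ?_
    rw [Polynomial.natDegree_eq_zero_of_isUnit hunit, zero_add, zero_add]
    exact natDegree_restrictLine_le _ _ _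
  have h2 := (mem_residualForms.1 hα).1.totalDegree_le
  rw [MvPolynomial.totalDegree_mul_of_isDomain (mul_ne_zero hf0 hf0) hg0,
    MvPolynomial.totalDegree_mul_of_isDomain hf0 hf0] at h2
  have h3 : f = MvPolynomial.C _ := MvPolynomial.totalDegree_eq_zero_iff_eq_C.1 (by omega)
  have h4 : MvPolynomial.coeff 0 f ≠ 0 := fun h0 => hf0 (by rw [h3, h0, MvPolynomial.C_0])
  rw [h3]
  exact (IsUnit.mk0 _ h4).map MvPolynomial.C

/-- A linear relation between the Wachspress coordinates on the adjoint hypersurface arises from an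
identity `α * h = ∑ c u • ω u` with an affine linear form `h`. -/
theorem IsSimpleArrangement.exists_coeff_eq [Fintype P.vertices] (hP : P.IsSimpleArrangement)
    (hn : 0 < n) {α : MvPolynomial (Fin (n + 1)) ℂ} (hα : α ∈ P.residualForms (d - n - 1))
    (hX : ∀ k, MvPolynomial.X k * α = P.weightedSum k) {c : P.vertices → ℂ}
    (hc : ∀ x, MvPolynomial.eval x α = 0 →
      ∑ u, c u * MvPolynomial.eval x (P.wachspressForm u) = 0) :
    ∃ y : Fin (n + 1) → ℂ, ∀ u : P.vertices,
      c u = P.normalVolume (P.tight u) * ∑ k, y k * homogenize (u : Fin n → ℝ) k := by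
  have hnd := P.lt_card_facets hn
  have hα0 := hP.ne_zero_of_X_mul_eq hn hX
  set g := ∑ u, c u • P.wachspressForm u with hg
  have hgx : ∀ x, MvPolynomial.eval x g = ∑ u, c u * MvPolynomial.eval x (P.wachspressForm u) :=
    fun x => by simp only [hg, map_sum, MvPolynomial.smul_eval]
  obtain ⟨h, hgh⟩ : α ∣ g := by
    have hmem : g ∈ (Ideal.span {α}).radical := by
      rw [← MvPolynomial.vanishingIdeal_zeroLocus_eq_radical (K := ℂ),
        MvPolynomial.mem_vanishingIdeal_iff]
      intro x hx
      have := MvPolynomial.mem_zeroLocus_iff.1 hx α (Ideal.mem_span_singleton_self α)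
      rw [MvPolynomial.aeval_eq_eval] at this ⊢
      exact (hgx x).trans (hc x this)
    obtain ⟨m, hm⟩ := hmem
    exact (hP.squarefree_adjoint hn hα hX).isRadical m g (Ideal.mem_span_singleton.1 hm)
  have hdeg : h.totalDegree ≤ 1 := by
    by_cases h0 : h = 0
    · simp [h0]
    have h1 : g.totalDegree ≤ d - n :=
      (MvPolynomial.IsHomogeneous.sum _ _ _ fun u _ =>
        (MvPolynomial.homogeneousSubmodule _ ℂ _).smul_mem _
          (hP.wachspressForm_isHomogeneous u)).totalDegree_le
    rw [hgh, MvPolynomial.totalDegree_mul_of_isDomain hα0 h0,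
      (mem_residualForms.1 hα).1.totalDegree hα0] at h1
    omega
  have hh : h = MvPolynomial.homogeneousComponent 0 h + MvPolynomial.homogeneousComponent 1 h := by
    conv_lhs => rw [← MvPolynomial.sum_homogeneousComponent h]
    rw [Finset.sum_subset (s₂ := Finset.range 2)
      (Finset.range_subset_range.2 (by omega)) fun m _ hm =>
        MvPolynomial.homogeneousComponent_eq_zero _ _ (by simpa using hm)]
    simp [Finset.sum_range_succ]
  have h1 : MvPolynomial.homogeneousComponent 1 h ∈
      Submodule.span ℂ (Set.range (MvPolynomial.X : Fin (n + 1) → MvPolynomial (Fin (n + 1)) ℂ)) := by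
    rw [← MvPolynomial.homogeneousSubmodule_one_eq_span_X]
    exact MvPolynomial.homogeneousComponent_mem _ _
  obtain ⟨y, hy⟩ := (Submodule.mem_span_range_iff_exists_fun ℂ).1 h1
  refine ⟨y + Pi.single 0 (MvPolynomial.coeff 0 h), fun u => ?_⟩
  -- evaluation of `α * h = g` at the vertex
  have hval := hgx (homogenize (u : Fin n → ℝ))
  rw [hgh, map_mul, (hP.eval_homogenize_ne_zero hn hX u).1,
    Finset.sum_eq_single_of_mem u (Finset.mem_univ _)] at hval
  · have hw := eval_wachspressForm_homogenize_self_ne_zero u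
    rw [hh, ← hy, MvPolynomial.homogeneousComponent_zero] at hval
    simp only [map_add, map_sum, MvPolynomial.eval_C, MvPolynomial.smul_eval, MvPolynomial.eval_X]
      at hval
    simp only [Pi.add_apply, add_mul, Finset.sum_add_distrib]
    rw [Finset.sum_eq_single_of_mem (f := fun k => (Pi.single 0 _ : Fin (n + 1) → ℂ) k * _) 0
      (Finset.mem_univ _) fun k _ hk => by rw [Pi.single_eq_of_ne hk, zero_mul]]
    rw [Pi.single_eq_same, homogenize_zero, mul_one]
    refine mul_right_cancel₀ hw ?_
    linear_combination -hval
  · intro w _ hw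
    rw [hP.eval_wachspressForm_homogenize_of_ne hn hw, mul_zero]

end Polytope

/-! ### Rational maps in homogeneous coordinates -/

theorem mem_formsMap_mk {σ τ : Type} [Fintype σ] {F : τ → MvPolynomial σ ℂ} {m : ℕ}
    (hF : ∀ j, (F j).IsHomogeneous m) {x : σ → ℂ} (hx : x ≠ 0) {q : ProjSpace τ} :
    q ∈ formsMap F (Projectivization.mk ℂ x hx) ↔
      ∃ h : (fun j => MvPolynomial.eval x (F j)) ≠ 0, q = Projectivization.mk ℂ _ h := by
  obtain ⟨c, hc⟩ := Projectivization.exists_smul_eq_mk_rep ℂ x hx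
  have hrep : (fun j => MvPolynomial.eval (Projectivization.mk ℂ x hx).rep (F j)) =
      ((c : ℂ) ^ m) • fun j => MvPolynomial.eval x (F j) := by
    ext j
    rw [← hc, Units.smul_def, eval_smul_of_isHomogeneous (hF j)]
    rfl
  constructor
  · rintro ⟨h, rfl⟩
    have h' : (fun j => MvPolynomial.eval (Projectivization.mk ℂ x hx).rep (F j)) ≠ 0 := h
    rw [hrep] at h'
    exact ⟨right_ne_zero_of_smul h',
      (Projectivization.mk_eq_mk_iff' ℂ _ _ _ _).2 ⟨_, hrep.symm⟩⟩
  · rintro ⟨h, rfl⟩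
    refine ⟨?_, ?_⟩
    · change (fun j => MvPolynomial.eval (Projectivization.mk ℂ x hx).rep (F j)) ≠ 0
      rw [hrep]
      exact smul_ne_zero (pow_ne_zero _ c.ne_zero) h
    · exact (Projectivization.mk_eq_mk_iff' ℂ _ _ _ _).2 ⟨_, hrep.symm⟩

theorem mem_linearProjection_mk {σ τ : Type} {L : (σ → ℂ) →ₗ[ℂ] (τ → ℂ)} {x : σ → ℂ} (hx : x ≠ 0)
    {q : ProjSpace τ} : q ∈ linearProjection L (Projectivization.mk ℂ x hx) ↔
      ∃ h : L x ≠ 0, q = Projectivization.mk ℂ _ h := by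
  obtain ⟨c, hc⟩ := Projectivization.exists_smul_eq_mk_rep ℂ x hx
  have hrep : L (Projectivization.mk ℂ x hx).rep = (c : ℂ) • L x := by
    rw [← hc, Units.smul_def, map_smul]
  constructor
  · rintro ⟨h, rfl⟩
    have h' : L (Projectivization.mk ℂ x hx).rep ≠ 0 := h
    rw [hrep] at h'
    exact ⟨right_ne_zero_of_smul h', (Projectivization.mk_eq_mk_iff' ℂ _ _ _ _).2 ⟨_, hrep.symm⟩⟩
  · rintro ⟨h, rfl⟩
    refine ⟨?_, (Projectivization.mk_eq_mk_iff' ℂ _ _ _ _).2 ⟨_, hrep.symm⟩⟩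
    change L (Projectivization.mk ℂ x hx).rep ≠ 0
    rw [hrep]
    exact smul_ne_zero c.ne_zero h

theorem mem_comp {α β γ : Type*} {f : α →. β} {g : β →. γ} {a : α} {c : γ} :
    c ∈ g.comp f a ↔ ∃ b ∈ f a, c ∈ g b := by
  rw [PFun.comp_apply]
  exact Part.mem_bind_iff

/-- A polynomial that vanishes in the nonzero vectors at which a given nonzero polynomial does not
vanish is zero. -/
theorem eq_zero_of_eval_eq_zero_of_ne {m : ℕ} {α f : MvPolynomial (Fin (m + 1)) ℂ} (hα : α ≠ 0)
    (h : ∀ x, x ≠ 0 → MvPolynomial.eval x α ≠ 0 → MvPolynomial.eval x f = 0) : f = 0 := by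
  have hz : MvPolynomial.X 0 * α * f = 0 := MvPolynomial.funext fun x => by
    by_cases hx : x 0 = 0
    · simp [hx]
    by_cases hαx : MvPolynomial.eval x α = 0
    · simp [hαx]
    · simp [h x (fun e => hx (by rw [e]; rfl)) hαx]
  exact (mul_eq_zero.1 hz).resolve_left (mul_ne_zero (MvPolynomial.X_ne_zero 0) hα)

namespace Polytope

variable {n d : ℕ} {P : Polytope n d}

/-! ### The projection from the span of the image of the adjoint -/

/-- The linear map with `e u ↦ c u • (1, u)`, where `c u` is the weight of the vertex `u`. -/
noncomputable def vertexMap (P : Polytope n d) [Fintype P.vertices] :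
    (P.vertices → ℂ) →ₗ[ℂ] (Fin (n + 1) → ℂ) :=
  Matrix.mulVecLin (Matrix.of fun k (u : P.vertices) =>
    (P.normalVolume (P.tight u) : ℂ) * homogenize (u : Fin n → ℝ) k)

theorem vertexMap_apply [Fintype P.vertices] (y : P.vertices → ℂ) (k : Fin (n + 1)) :
    P.vertexMap y k = ∑ u : P.vertices,
      ((P.normalVolume (P.tight u) : ℂ) * homogenize (u : Fin n → ℝ) k) * y u := rfl

/-- The values of the Wachspress coordinates at `x`. -/
noncomputable def wachspressVector (P : Polytope n d) (x : Fin (n + 1) → ℂ) : P.vertices → ℂ :=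
  fun u => MvPolynomial.eval x (P.wachspressForm u)

theorem IsSimpleArrangement.mem_wachspressMap_mk (hP : P.IsSimpleArrangement)
    {x : Fin (n + 1) → ℂ} (hx : x ≠ 0) {q : ProjSpace P.vertices} :
    q ∈ P.wachspressMap (Projectivization.mk ℂ x hx) ↔
      ∃ h : P.wachspressVector x ≠ 0, q = Projectivization.mk ℂ _ h :=
  mem_formsMap_mk hP.wachspressForm_isHomogeneous hx

theorem mem_wachspressVariety {p : ProjSpace (Fin (n + 1))} {q : ProjSpace P.vertices}
    (hq : q ∈ P.wachspressMap p) : q ∈ P.wachspressVariety :=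
  fun _ _ _ hf => hf q ⟨p, hq⟩

section Adjoint

variable [Fintype P.vertices] {α : MvPolynomial (Fin (n + 1)) ℂ}

theorem vertexMap_wachspressVector (hX : ∀ k, MvPolynomial.X k * α = P.weightedSum k)
    (x : Fin (n + 1) → ℂ) :
    P.vertexMap (P.wachspressVector x) = MvPolynomial.eval x α • x := by
  ext k
  have h := congrArg (MvPolynomial.eval x) (hX k)
  rw [map_mul, MvPolynomial.eval_X, eval_weightedSum] at h
  rw [vertexMap_apply, Pi.smul_apply, smul_eq_mul, mul_comm, h]
  rfl

theorem wachspressVector_ne_zero (hX : ∀ k, MvPolynomial.X k * α = P.weightedSum k)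
    {x : Fin (n + 1) → ℂ} (hx : x ≠ 0) (hα : MvPolynomial.eval x α ≠ 0) :
    P.wachspressVector x ≠ 0 := fun h => smul_ne_zero hα hx <| by
  rw [← vertexMap_wachspressVector hX, h, map_zero]

theorem IsSimpleArrangement.mem_adjointHypersurface_mk (hP : P.IsSimpleArrangement) (hn : 0 < n)
    (hα : α ∈ P.residualForms (d - n - 1)) (hX : ∀ k, MvPolynomial.X k * α = P.weightedSum k)
    {x : Fin (n + 1) → ℂ} (hx : x ≠ 0) :
    Projectivization.mk ℂ x hx ∈ P.adjointHypersurface ↔ MvPolynomial.eval x α = 0 := by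
  rw [← vanishesAt_mk (mem_residualForms.1 hα).1 hx]
  refine ⟨fun h => h α hα, fun h β hβ => ?_⟩
  obtain ⟨c, rfl⟩ := hP.exists_smul_adjoint_eq hn hα hX hβ
  rw [VanishesAt, MvPolynomial.smul_eval, h, mul_zero]

theorem IsSimpleArrangement.vertexMap_surjective (hP : P.IsSimpleArrangement) (hn : 0 < n)
    (hX : ∀ k, MvPolynomial.X k * α = P.weightedSum k) : Function.Surjective P.vertexMap := by
  rw [← LinearMap.range_eq_top]
  by_contra hne
  obtain ⟨f, hf, hle⟩ := Submodule.exists_le_ker_of_lt_top _ (lt_top_iff_ne_top.2 hne)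
  refine hf (LinearMap.pi_ext' fun k => LinearMap.ext_ring ?_)
  have hfx : ∀ x, f x = ∑ k, x k * f (Pi.single k 1) := fun x => by
    conv_lhs => rw [pi_eq_sum_univ' x]
    simp [map_sum]
  have hF : ∑ k, f (Pi.single k 1) • (MvPolynomial.X k : MvPolynomial (Fin (n + 1)) ℂ) = 0 := by
    refine eq_zero_of_eval_eq_zero_of_ne (hP.ne_zero_of_X_mul_eq hn hX) fun x _ hαx => ?_
    have h : f (P.vertexMap (P.wachspressVector x)) = 0 := hle ⟨_, rfl⟩
    rw [vertexMap_wachspressVector hX, map_smul, smul_eq_mul, mul_eq_zero, or_iff_right hαx,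
      hfx] at h
    simpa [MvPolynomial.smul_eval, mul_comm] using h
  have := congrArg (MvPolynomial.eval (Pi.single k 1)) hF
  simpa [MvPolynomial.smul_eval, Pi.single_apply] using this

theorem IsSimpleArrangement.ker_vertexMap (hP : P.IsSimpleArrangement) (hn : 0 < n)
    (hα : α ∈ P.residualForms (d - n - 1)) (hX : ∀ k, MvPolynomial.X k * α = P.weightedSum k) :
    LinearMap.ker P.vertexMap = Projectivization.Subspace.submodule P.adjointSpan := by
  have hnd := P.lt_card_facets hn
  apply le_antisymm
  · intro z hz
    by_contra hzS
    obtain ⟨f, hfz, hle⟩ := Submodule.exists_le_ker_of_notMem hzS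
    have hfx : ∀ y, f y = ∑ u, f (Pi.single u 1) * y u := fun y => by
      conv_lhs => rw [pi_eq_sum_univ' y]
      simp [map_sum, mul_comm]
    -- the coefficients of `f` are a linear relation on the image of the adjoint hypersurface
    obtain ⟨c, hc⟩ := hP.exists_coeff_eq hn hα hX (c := fun u => f (Pi.single u 1)) fun x hx => by
      refine (hfx (P.wachspressVector x)).symm.trans ?_
      by_cases hω : P.wachspressVector x = 0
      · rw [hω, map_zero]
      have hx0 : x ≠ 0 := fun h0 => hω <| funext fun u => by
        have := eval_smul_of_isHomogeneous (hP.wachspressForm_isHomogeneous u) 0 x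
        rwa [zero_smul, zero_pow (by omega), zero_mul, ← h0] at this
      refine hle ((Projectivization.Subspace.mem_submodule_iff _ hω).2 ?_)
      exact Projectivization.Subspace.subset_span _
        ⟨_, (hP.mem_adjointHypersurface_mk hn hα hX hx0).2 hx,
          (hP.mem_wachspressMap_mk hx0).2 ⟨hω, rfl⟩⟩
    refine hfz ?_
    have h : ∑ k, c k * P.vertexMap z k = 0 := by
      rw [LinearMap.mem_ker.1 hz]
      simp
    rw [hfx, ← h]
    simp only [vertexMap_apply, hc, Finset.mul_sum, Finset.sum_mul]
    rw [Finset.sum_comm]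
    exact Finset.sum_congr rfl fun k _ => Finset.sum_congr rfl fun u _ => by ring
  · rw [← (Projectivization.Subspace.submodule).apply_symm_apply (LinearMap.ker P.vertexMap),
      (Projectivization.Subspace.submodule).le_iff_le, adjointSpan,
      Projectivization.Subspace.span_le_subspace_iff]
    rintro q ⟨p, hp, hq⟩
    rw [← p.mk_rep] at hp hq
    obtain ⟨h, rfl⟩ := (hP.mem_wachspressMap_mk p.rep_nonzero).1 hq
    refine (Submodule.mk_mem_projectivization_iff _ h).2 ?_
    rw [LinearMap.mem_ker, vertexMap_wachspressVector hX,
      (hP.mem_adjointHypersurface_mk hn hα hX p.rep_nonzero).1 hp, zero_smul]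

theorem IsSimpleArrangement.projDim_adjointSpan (hP : P.IsSimpleArrangement) (hn : 0 < n)
    (hα : α ∈ P.residualForms (d - n - 1)) (hX : ∀ k, MvPolynomial.X k * α = P.weightedSum k) :
    projDim P.adjointSpan = (P.vertices.ncard : ℤ) - n - 2 := by
  have h := P.vertexMap.finrank_range_add_finrank_ker
  rw [LinearMap.range_eq_top.2 (hP.vertexMap_surjective hn hX), finrank_top, Module.finrank_pi,
    Module.finrank_pi, Fintype.card_fin, hP.ker_vertexMap hn hα hX, ← Nat.card_eq_fintype_card,
    Nat.card_coe_set_eq] at h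
  rw [projDim]
  omega

/-! ### The inverse of the Wachspress map -/

/-- Outside of the adjoint hypersurface, both maps are defined. -/
theorem IsSimpleArrangement.mk_mem_linearProjection (hP : P.IsSimpleArrangement)
    (hX : ∀ k, MvPolynomial.X k * α = P.weightedSum k) {x : Fin (n + 1) → ℂ} (hx : x ≠ 0)
    (hαx : MvPolynomial.eval x α ≠ 0) :
    ∃ q ∈ P.wachspressMap (Projectivization.mk ℂ x hx),
      Projectivization.mk ℂ x hx ∈ linearProjection P.vertexMap q := by
  refine ⟨_, (hP.mem_wachspressMap_mk hx).2 ⟨wachspressVector_ne_zero hX hx hαx, rfl⟩,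
    (mem_linearProjection_mk _).2 ⟨?_, ?_⟩⟩
  · rw [vertexMap_wachspressVector hX]
    exact smul_ne_zero hαx hx
  · refine (Projectivization.mk_eq_mk_iff' ℂ _ _ _ _).2 ⟨(MvPolynomial.eval x α)⁻¹, ?_⟩
    rw [vertexMap_wachspressVector hX, inv_smul_smul₀ hαx]

/-- On the image of the Wachspress map, and hence on its Zariski closure, the vectors `y` and
`ω (L y)` are proportional, where `L` is the projection. -/
theorem IsSimpleArrangement.wachspressVector_vertexMap (hP : P.IsSimpleArrangement)
    (hX : ∀ k, MvPolynomial.X k * α = P.weightedSum k) {y : P.vertices → ℂ} (hy : y ≠ 0)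
    (hyW : Projectivization.mk ℂ y hy ∈ P.wachspressVariety) (u v : P.vertices) :
    y u * P.wachspressVector (P.vertexMap y) v = y v * P.wachspressVector (P.vertexMap y) u := by
  let Λ : Fin (n + 1) → MvPolynomial P.vertices ℂ := fun k => ∑ u : P.vertices,
    MvPolynomial.C ((P.normalVolume (P.tight u) : ℂ) * homogenize (u : Fin n → ℝ) k) *
      MvPolynomial.X u
  have hΛ : ∀ y k, MvPolynomial.eval y (Λ k) = P.vertexMap y k := fun y k => by
    simp [Λ, vertexMap_apply]
  let ω : P.vertices → MvPolynomial P.vertices ℂ := fun w => MvPolynomial.aeval Λ (P.wachspressForm w)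
  have hω : ∀ y w, MvPolynomial.eval y (ω w) = P.wachspressVector (P.vertexMap y) w := fun y w => by
    have : ((MvPolynomial.aeval y).comp (MvPolynomial.aeval Λ)) (P.wachspressForm w) =
        MvPolynomial.aeval (P.vertexMap y) (P.wachspressForm w) := by
      congr 1
      ext k
      simp only [AlgHom.comp_apply, MvPolynomial.aeval_X, MvPolynomial.aeval_eq_eval]
      exact hΛ y k
    rwa [AlgHom.comp_apply, MvPolynomial.aeval_eq_eval, MvPolynomial.aeval_eq_eval] at this
  have hωhom : ∀ w, (ω w).IsHomogeneous (1 * (d - n)) := fun w =>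
    (hP.wachspressForm_isHomogeneous w).aeval _ fun k =>
      MvPolynomial.IsHomogeneous.sum _ _ _ fun _ _ => MvPolynomial.isHomogeneous_C_mul_X _ _
  have hhom : (MvPolynomial.X u * ω v - MvPolynomial.X v * ω u).IsHomogeneous (1 + 1 * (d - n)) :=
    ((MvPolynomial.isHomogeneous_X ℂ u).mul (hωhom v)).sub
      ((MvPolynomial.isHomogeneous_X ℂ v).mul (hωhom u))
  have h := (vanishesAt_mk hhom hy).1 (hyW _ _ hhom fun q ⟨p, hq⟩ => by
    rw [← p.mk_rep] at hq
    obtain ⟨hne, rfl⟩ := (hP.mem_wachspressMap_mk p.rep_nonzero).1 hq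
    rw [vanishesAt_mk hhom hne]
    simp only [map_sub, map_mul, MvPolynomial.eval_X, hω, vertexMap_wachspressVector hX]
    simp only [wachspressVector, eval_smul_of_isHomogeneous (hP.wachspressForm_isHomogeneous _)]
    ring)
  simpa only [map_sub, map_mul, MvPolynomial.eval_X, hω, sub_eq_zero] using h

theorem IsSimpleArrangement.areInverse (hP : P.IsSimpleArrangement) (hn : 0 < n)
    (hX : ∀ k, MvPolynomial.X k * α = P.weightedSum k) :
    AreInverse Set.univ P.wachspressVariety P.wachspressMap (linearProjection P.vertexMap) where
  maps_to := fun _ _ _ hq => mem_wachspressVariety hq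
  maps_from := fun _ _ _ _ => Set.mem_univ _
  dense_left := by
    intro p _ m f hf hvan
    have : f = 0 := eq_zero_of_eval_eq_zero_of_ne (hP.ne_zero_of_X_mul_eq hn hX) fun x hx hαx => by
      obtain ⟨q, hq, hpq⟩ := hP.mk_mem_linearProjection hX hx hαx
      exact (vanishesAt_mk hf hx).1
        (hvan _ ⟨Set.mem_univ _, (PFun.mem_dom _ _).2 ⟨_, mem_comp.2 ⟨q, hq, hpq⟩⟩⟩)
    rw [this, VanishesAt, map_zero]
  dense_right := by
    intro q hqW m f hf hvan
    have heval : ∀ x, MvPolynomial.eval x (MvPolynomial.aeval P.wachspressForm f) =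
        MvPolynomial.eval (P.wachspressVector x) f := fun x => by
      have : ((MvPolynomial.aeval x).comp (MvPolynomial.aeval P.wachspressForm)) f =
          MvPolynomial.aeval (P.wachspressVector x) f := by
        congr 1
        ext u
        simp [MvPolynomial.aeval_eq_eval, wachspressVector]
      simpa [MvPolynomial.aeval_eq_eval] using this
    have hzero : MvPolynomial.aeval P.wachspressForm f = 0 :=
      eq_zero_of_eval_eq_zero_of_ne (hP.ne_zero_of_X_mul_eq hn hX) fun x hx hαx => by
        obtain ⟨q, hq, hpq⟩ := hP.mk_mem_linearProjection hX hx hαx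
        have h := hvan q ⟨mem_wachspressVariety hq,
          (PFun.mem_dom _ _).2 ⟨q, mem_comp.2 ⟨_, hpq, hq⟩⟩⟩
        obtain ⟨hne, rfl⟩ := (hP.mem_wachspressMap_mk hx).1 hq
        rw [heval]
        exact (vanishesAt_mk hf hne).1 h
    refine hqW m f hf ?_
    rintro r ⟨p, hr⟩
    rw [← p.mk_rep] at hr
    obtain ⟨hne, rfl⟩ := (hP.mem_wachspressMap_mk p.rep_nonzero).1 hr
    rw [vanishesAt_mk hf hne, ← heval, hzero, map_zero]
  left_inv := by
    intro p _ p' hp'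
    obtain ⟨q, hq, hp'q⟩ := mem_comp.1 hp'
    rw [← p.mk_rep] at hq ⊢
    obtain ⟨hne, rfl⟩ := (hP.mem_wachspressMap_mk p.rep_nonzero).1 hq
    obtain ⟨hne', rfl⟩ := (mem_linearProjection_mk hne).1 hp'q
    exact (Projectivization.mk_eq_mk_iff' ℂ _ _ _ _).2
      ⟨_, (vertexMap_wachspressVector hX p.rep).symm⟩
  right_inv := by
    intro q hqW q' hq'
    obtain ⟨p, hp, hq'p⟩ := mem_comp.1 hq'
    rw [← q.mk_rep] at hp hqW ⊢
    obtain ⟨hne, rfl⟩ := (mem_linearProjection_mk q.rep_nonzero).1 hp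
    obtain ⟨hne', rfl⟩ := (hP.mem_wachspressMap_mk hne).1 hq'p
    obtain ⟨v, hv⟩ := Function.ne_iff.1 q.rep_nonzero
    refine (Projectivization.mk_eq_mk_iff' ℂ _ _ _ _).2
      ⟨P.wachspressVector (P.vertexMap q.rep) v / q.rep v, funext fun u => ?_⟩
    have h := hP.wachspressVector_vertexMap hX q.rep_nonzero hqW u v
    have hv' : q.rep v ≠ 0 := hv
    rw [Pi.smul_apply, smul_eq_mul]
    field_simp
    linear_combination h

end Adjoint

end Polytope

end Wachspress

theorem theorem1p5 (n d : ℕ) (hn : 0 < n) (P : Wachspress.Polytope n d) (hP : P.IsSimpleArrangement) :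
    -- the adjoint hypersurface is well defined
    Module.finrank ℂ (P.residualForms (d - n - 1)) = 1 ∧
    -- the Wachspress coordinates are a basis of the space `Ω_P`
    LinearIndependent ℂ P.wachspressForm ∧
    Submodule.span ℂ (Set.range P.wachspressForm) = P.residualForms (d - n) ∧
    -- the dimension of `V_P`
    Wachspress.projDim P.adjointSpan = (P.vertices.ncard : ℤ) - n - 2 ∧
    -- the projection from `V_P`, restricted to `W_P`, is the inverse of the Wachspress map
    ∃ L : (P.vertices → ℂ) →ₗ[ℂ] (Fin (n + 1) → ℂ),
      Function.Surjective L ∧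
      LinearMap.ker L = Projectivization.Subspace.submodule P.adjointSpan ∧
      Wachspress.AreInverse Set.univ P.wachspressVariety P.wachspressMap (Wachspress.linearProjection L) := by
  have := (hP.finite_vertices hn).fintype
  obtain ⟨α, hα, hX⟩ := hP.exists_adjoint hn
  refine ⟨?_, hP.linearIndependent_wachspressForm hn, hP.span_wachspressForm hn,
    hP.projDim_adjointSpan hn hα hX, P.vertexMap, hP.vertexMap_surjective hn hX,
    hP.ker_vertexMap hn hα hX, hP.areInverse hn hX⟩
  refine (finrank_eq_one_iff_of_nonzero' ⟨α, hα⟩ fun h =>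
    hP.ne_zero_of_X_mul_eq hn hX (congrArg Subtype.val h)).2 fun β => ?_
  obtain ⟨c, hc⟩ := hP.exists_smul_adjoint_eq hn hα hX β.2
  exact ⟨c, Subtype.ext hc⟩
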